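/- **Setting.** Pauli operators on a register of qubits are tensor products of $I,X,Y,Z$ times a power of $i$; the weight $|P|$ is the number of non-identity tensor factors. A stabilizer code $C_0$ on $n_0$ qubits is given by a commutative group $\mathcal S_0$ of Pauli operators with $-I\notin\mathcal S_0$; its code space is the joint $+1$ eigenspace of $\mathcal S_0$, and its distance is the minimum weight of a Pauli operator that commutes with $\mathcal S_0$ and is not, up to a phase, in $\mathcal S_0$. For a subsystem code with gauge group $\mathcal G$, the stabilizer group $\mathcal S$ is the centre of $\mathcal G$ up to phases, and the distance is the minimum weight of a nontrivial dressed logical operator, i.e. of a Pauli operator that commutes with $\mathcal S$ and is not, up to a phase, in $\mathcal G$. (Both minima are $\infty$ if there is no such operator.) **Circuits.** A Clifford circuit $V$ has $n_0$ data wires and $n_a$ ancilla wires. Wire $w$ is present at the integer times $T^{\rm in}_w,\dots,T^{\rm out}_w$, where $0\le T^{\rm in}_w\le T^{\rm out}_w$. Each ancilla is initialized to $|0\rangle$ just before $T^{\rm in}_w$ and postselected onto $\langle 0|$ just after $T^{\rm out}_w$. Between times $t$ and $t+1$ the wires present at both times are partitioned into blocks, and a Clifford gate (possibly the identity) acts on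 each block; the product of these gates is $U_{t+1/2}$. On the data wires all $T^{\rm in}_w$ and $T^{\rm out}_w$ are even. An error pattern $E$ assigns a Pauli matrix $E_{w,t}\in\{I,X,Y,Z\}$ to each location $(w,t)$, $T^{\rm in}_w\le t\le T^{\rm out}_w$; $|E|$ is the number of non-identity entries, and $E_t$ is the slice at time $t$. With $T=\max_w T^{\rm out}_w$, $$V_E=(I^{\otimes n_0}\otimes\langle 0|^{\otimes n_a})\,E_TU_{T-1/2}E_{T-1}\cdots U_{1/2}E_0\,(I^{\otimes n_0}\otimes|0\rangle^{\otimes n_a}),$$ and $V$ also denotes the operator $V_E$ for the trivial pattern. Say that $E$ is equivalent to a Pauli error $F$ on the data inputs if $V_E=V F$ up to a phase. * $V$ is a *good error-detecting circuit* for $C_0$ if $V^\dagger V$ is a nonzero multiple of the orthogonal projector onto the code space of $C_0$. * $V$ is *fault-tolerant* if for every error pattern $E$: either $V_E=0$, or $E$ is not equivalent to any Pauli error on the data inputs, or $E$ is equivalent to a Pauli error $E'$ on the data inputs with $|E'|\le|E|$. **Localized code.** The localized subsystem code of $V$ has one physical qubit for each location $(w,t)$. Let $\eta_t(P)$ denote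 the operator $P$ placed on the corresponding qubits at time $t$. The gauge group is generated by $\eta_{t+1}(UPU^\dagger)\,\eta_t(P)$, for every gate $U$ between times $t$ and $t+1$ and every single-qubit $X$ or $Z$ operator $P$ on one of the wires of $U$, together with the operator $Z$ at $(w,T^{\rm in}_w)$ and the operator $Z$ at $(w,T^{\rm out}_w)$ for each ancilla wire $w$. **Theorem.** If $V$ is a fault-tolerant good error-detecting Clifford circuit for a stabilizer code of distance $d$, then the localized subsystem code built from $V$ has distance $d$. -/

import Mathlib

/-! ### Qubits, operators and Pauli operators -/

/-- Computational basis labels of a register of qubits indexed by `ι`. -/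
abbrev Basis2 (ι : Type) : Type := ι → Fin 2

/-- Operators on a register of qubits, as matrices in the computational basis. -/
abbrev QOp (ι : Type) : Type := Matrix (Basis2 ι) (Basis2 ι) ℂ

/-- The unitary group of a register of qubits. -/
abbrev QUnitary (ι : Type) [Fintype ι] [DecidableEq ι] : Type :=
  ↥(Matrix.unitaryGroup (Basis2 ι) ℂ)

/-- A single-qubit Pauli type: `(x, z)` stands for `X ^ x * Z ^ z`, so `(0,0)`, `(1,0)`, `(0,1)`,
`(1,1)` are `I`, `X`, `Z` and `X Z = -iY`. -/
abbrev Pauli : Type := ZMod 2 × ZMod 2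

/-- The label of `X`. -/
def Pauli.X : Pauli := (1, 0)

/-- The label of `Z`. -/
def Pauli.Z : Pauli := (0, 1)

/-- The single-qubit matrix `X ^ x * Z ^ z`. -/
def pauliMatrix (p : Pauli) : Matrix (Fin 2) (Fin 2) ℂ :=
  !![0, 1; 1, 0] ^ p.1.val * !![1, 0; 0, -1] ^ p.2.val

/-- The tensor product of a family of single-qubit matrices. -/
def tensorOp {ι : Type} [Fintype ι] (A : ι → Matrix (Fin 2) (Fin 2) ℂ) : QOp ι :=
  Matrix.of fun a b => ∏ i, A i (a i) (b i)

/-- The tensor product of single-qubit Pauli matrices (with phase `1`). -/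
def pauliOp {ι : Type} [Fintype ι] (p : ι → Pauli) : QOp ι :=
  tensorOp fun i => pauliMatrix (p i)

theorem tensorOp_mul {ι : Type} [Fintype ι] [DecidableEq ι]
    (A B : ι → Matrix (Fin 2) (Fin 2) ℂ) :
    tensorOp A * tensorOp B = tensorOp fun i => A i * B i := by
  ext a b
  simp only [tensorOp, Matrix.mul_apply, Matrix.of_apply]
  rw [Finset.prod_univ_sum, Fintype.piFinset_univ]
  simp [Finset.prod_mul_distrib]

theorem tensorOp_one {ι : Type} [Fintype ι] [DecidableEq ι] :
    tensorOp (fun _ : ι => (1 : Matrix (Fin 2) (Fin 2) ℂ)) = 1 := by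
  ext a b
  by_cases h : a = b
  · subst h; simp [tensorOp]
  · obtain ⟨i, hi⟩ := Function.ne_iff.mp h
    simp only [tensorOp, Matrix.of_apply, Matrix.one_apply_ne h]
    exact Finset.prod_eq_zero (Finset.mem_univ i) (Matrix.one_apply_ne hi)

theorem tensorOp_star {ι : Type} [Fintype ι] (A : ι → Matrix (Fin 2) (Fin 2) ℂ) :
    star (tensorOp A) = tensorOp fun i => star (A i) := by
  ext a b
  simp [tensorOp, Matrix.star_apply]

theorem pauliMatrix_mul_star (p : Pauli) : pauliMatrix p * star (pauliMatrix p) = 1 := by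
  have hX : (!![0, 1; 1, 0] : Matrix (Fin 2) (Fin 2) ℂ) ∈ Matrix.unitaryGroup (Fin 2) ℂ := by
    rw [Matrix.mem_unitaryGroup_iff]
    ext i j
    fin_cases i <;> fin_cases j <;> simp [Matrix.mul_apply, Matrix.star_apply]
  have hZ : (!![1, 0; 0, -1] : Matrix (Fin 2) (Fin 2) ℂ) ∈ Matrix.unitaryGroup (Fin 2) ℂ := by
    rw [Matrix.mem_unitaryGroup_iff]
    ext i j
    fin_cases i <;> fin_cases j <;> simp [Matrix.mul_apply, Matrix.star_apply]
  exact Matrix.mem_unitaryGroup_iff.mp (mul_mem (pow_mem hX _) (pow_mem hZ _))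

/-- `pauliOp p` as an element of the unitary group. -/
def pauliU {ι : Type} [Fintype ι] [DecidableEq ι] (p : ι → Pauli) : QUnitary ι :=
  ⟨pauliOp p, by
    rw [Matrix.mem_unitaryGroup_iff, pauliOp, tensorOp_star, tensorOp_mul]
    simp only [pauliMatrix_mul_star]
    exact tensorOp_one⟩

/-- The number of non-identity tensor factors of a Pauli operator. -/
def pauliWeight {ι : Type} [Fintype ι] (p : ι → Pauli) : ℕ :=
  (Finset.univ.filter fun i => p i ≠ 0).card

/-- Membership in the Pauli group: a tensor product of Pauli matrices times a power of `i`. -/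
def IsPauli {ι : Type} [Fintype ι] [DecidableEq ι] (u : QUnitary ι) : Prop :=
  ∃ (c : ℂ) (p : ι → Pauli), c ^ 4 = 1 ∧ (u : QOp ι) = c • pauliOp p

/-- A Clifford unitary: conjugation by it maps Pauli operators to Pauli operators. -/
def IsClifford {ι : Type} [Fintype ι] [DecidableEq ι] (U : QUnitary ι) : Prop :=
  ∀ P : QUnitary ι, IsPauli P → IsPauli (U * P * U⁻¹)

/-! ### Placing an operator on part of a register -/

open Classical in
/-- The operator that acts as `M` on the qubits `f k`, `k : κ`, and as the identity on the
other qubits of the register `ι`. -/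
noncomputable def placeOp {κ ι : Type} (f : κ ↪ ι) (M : QOp κ) : QOp ι :=
  Matrix.of fun a b => if ∀ i, i ∉ Set.range f → a i = b i then M (a ∘ f) (b ∘ f) else 0

theorem placeOp_mul {κ ι : Type} [Fintype κ] [DecidableEq κ] [Fintype ι] [DecidableEq ι]
    (f : κ ↪ ι) (M N : QOp κ) : placeOp f M * placeOp f N = placeOp f (M * N) := by
  classical
  ext a b
  simp only [placeOp, Matrix.mul_apply, Matrix.of_apply]
  let ext' : Basis2 κ → Basis2 ι := fun x i =>
    if h : ∃ k, f k = i then x h.choose else a i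
  have ext_f : ∀ x k, ext' x (f k) = x k := fun x k => by
    have h : ∃ k', f k' = f k := ⟨k, rfl⟩
    simp only [ext', dif_pos h]
    exact congrArg x (f.injective h.choose_spec)
  have ext_off : ∀ x i, i ∉ Set.range f → ext' x i = a i := fun x i hi => by
    have h : ¬ ∃ k, f k = i := hi
    simp only [ext', dif_neg h]
  have ext_comp : ∀ x, ext' x ∘ f = x := fun x => funext fun k => ext_f x k
  have inj : Function.Injective ext' := fun x y h => by
    rw [← ext_comp x, ← ext_comp y, h]
  rw [← Finset.sum_subset (Finset.subset_univ (Finset.univ.image ext'))]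
  · rw [Finset.sum_image fun x _ y _ h => inj h]
    by_cases hab : ∀ i, i ∉ Set.range f → a i = b i
    · rw [if_pos hab]
      refine Finset.sum_congr rfl fun x _ => ?_
      rw [if_pos fun i hi => (ext_off x i hi).symm,
        if_pos fun i hi => (ext_off x i hi).trans (hab i hi), ext_comp]
    · rw [if_neg hab]
      refine Finset.sum_eq_zero fun x _ => ?_
      rw [if_neg (c := ∀ i, i ∉ Set.range f → ext' x i = b i), mul_zero]
      exact fun h => hab fun i hi => (ext_off x i hi).symm.trans (h i hi)
  · intro c _ hc
    rw [if_neg, zero_mul]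
    intro h
    refine hc (Finset.mem_image.mpr ⟨c ∘ f, Finset.mem_univ _, funext fun i => ?_⟩)
    by_cases hi : i ∈ Set.range f
    · obtain ⟨k, rfl⟩ := hi
      exact ext_f _ k
    · rw [ext_off _ i hi, h i hi]

theorem placeOp_one {κ ι : Type} [DecidableEq κ] [DecidableEq ι] [Fintype κ] [Fintype ι]
    (f : κ ↪ ι) : placeOp f (1 : QOp κ) = 1 := by
  classical
  ext a b
  simp only [placeOp, Matrix.of_apply, Matrix.one_apply]
  by_cases hab : a = b
  · subst hab; simp
  · rw [if_neg hab]
    by_cases h : ∀ i, i ∉ Set.range f → a i = b i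
    · rw [if_pos h, if_neg]
      intro hf
      refine hab (funext fun i => ?_)
      by_cases hi : i ∈ Set.range f
      · obtain ⟨k, rfl⟩ := hi
        exact congrFun hf k
      · exact h i hi
    · rw [if_neg h]

theorem placeOp_star {κ ι : Type} (f : κ ↪ ι) (M : QOp κ) :
    star (placeOp f M) = placeOp f (star M) := by
  classical
  ext a b
  simp only [placeOp, Matrix.of_apply, Matrix.star_apply]
  by_cases h : ∀ i, i ∉ Set.range f → a i = b i
  · rw [if_pos h, if_pos fun i hi => (h i hi).symm]
  · rw [if_neg h, if_neg fun h' => h fun i hi => (h' i hi).symm, star_zero]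

/-- `placeOp` on unitary operators. -/
noncomputable def placeU {κ ι : Type} [Fintype κ] [DecidableEq κ] [Fintype ι] [DecidableEq ι]
    (f : κ ↪ ι) (u : QUnitary κ) : QUnitary ι :=
  ⟨placeOp f u.1, by
    rw [Matrix.mem_unitaryGroup_iff, placeOp_star, placeOp_mul,
      Matrix.mem_unitaryGroup_iff.mp u.2, placeOp_one]⟩

/-! ### Stabilizer and subsystem codes -/

/-- A stabilizer code on `n` qubits: a commutative group of Pauli operators not containing `-I`. -/
structure StabilizerCode (n : ℕ) where
  group : Subgroup (QUnitary (Fin n))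
  isPauli : ∀ s ∈ group, IsPauli s
  comm : ∀ s ∈ group, ∀ s' ∈ group, s * s' = s' * s
  neg_one_notMem : ∀ s ∈ group, (s : QOp (Fin n)) ≠ -1

/-- The code space: the joint `+1` eigenspace of the stabilizer group. -/
def StabilizerCode.codeSpace {n : ℕ} (C : StabilizerCode n) :
    Submodule ℂ (Basis2 (Fin n) → ℂ) where
  carrier := {ψ | ∀ s ∈ C.group, (s : QOp (Fin n)).mulVec ψ = ψ}
  add_mem' := fun {x y} hx hy s hs => by rw [Matrix.mulVec_add, hx s hs, hy s hs]
  zero_mem' := fun s _ => Matrix.mulVec_zero _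
  smul_mem' := fun c x hx s hs => by rw [Matrix.mulVec_smul, hx s hs]

/-- The smallest weight of a Pauli operator that lies in `A` and is not, up to a phase,
an element of `B`; it is `⊤` if there is no such Pauli operator. -/
noncomputable def minWeight {ι : Type} [Fintype ι] [DecidableEq ι]
    (A B : Subgroup (QUnitary ι)) : ℕ∞ :=
  ⨅ p ∈ {p : ι → Pauli | pauliU p ∈ A ∧ ¬ ∃ g ∈ B, ∃ c : ℂ, pauliOp p = c • (g : QOp ι)},
    (pauliWeight p : ℕ∞)

/-- The distance of a stabilizer code: the smallest weight of a Pauli operator that commutes with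
the stabilizer group and is not itself (up to a phase) a stabilizer. -/
noncomputable def StabilizerCode.distance {n : ℕ} (C : StabilizerCode n) : ℕ∞ :=
  minWeight (Subgroup.centralizer (C.group : Set (QUnitary (Fin n)))) C.group

/-- The centre of the gauge group. The stabilizer group of a subsystem code is the centre of its
gauge group, up to a choice of phases. -/
def gaugeCenter {ι : Type} [Fintype ι] [DecidableEq ι] (G : Subgroup (QUnitary ι)) :
    Subgroup (QUnitary ι) :=
  G ⊓ Subgroup.centralizer (G : Set (QUnitary ι))

/-- The distance of the subsystem code with gauge group `G`: the smallest weight of a nontrivial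
dressed logical operator, i.e. of a Pauli operator that commutes with all stabilizers
(the choice of their phases does not matter here) and is not, up to a phase, in `G`. -/
noncomputable def subsystemDistance {ι : Type} [Fintype ι] [DecidableEq ι]
    (G : Subgroup (QUnitary ι)) : ℕ∞ :=
  minWeight (Subgroup.centralizer (gaugeCenter G : Set (QUnitary ι))) G

/-! ### Clifford circuits with staggered initializations and postselections -/

/-- A Clifford circuit with `n₀` data wires `Sum.inl i` and `nₐ` ancilla wires `Sum.inr j`.
Wire `w` occupies the integer times `tin w, …, tout w`; ancillas are initialized to `|0⟩` just
before `tin` and postselected onto `⟨0|` just after `tout`. Between the times `t` and `t + 1` the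
wires that are present at both times are partitioned into blocks, and a Clifford gate
(possibly the identity) acts on each block. The values of `gate t B` for other `B` are not used. -/
structure CliffordCircuit (n₀ nₐ : ℕ) where
  tin : Fin n₀ ⊕ Fin nₐ → ℕ
  tout : Fin n₀ ⊕ Fin nₐ → ℕ
  tin_le_tout : ∀ w, tin w ≤ tout w
  layer : (t : ℕ) → Finpartition (Finset.univ.filter fun w => tin w ≤ t ∧ t + 1 ≤ tout w)
  gate : (t : ℕ) → (B : Finset (Fin n₀ ⊕ Fin nₐ)) → QUnitary B
  isClifford : ∀ t, ∀ B ∈ (layer t).parts, IsClifford (gate t B)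

namespace CliffordCircuit

variable {n₀ nₐ : ℕ}

/-- The spacetime locations `(w, t)` of the circuit, `tin w ≤ t ≤ tout w`. They carry the physical
qubits of the localized code. -/
abbrev Location (V : CliffordCircuit n₀ nₐ) : Type :=
  Σ w : Fin n₀ ⊕ Fin nₐ, ↥(Finset.Icc (V.tin w) (V.tout w))

/-- Every data line has its input and its output at an even time, so that it holds an odd number of
locations. (An arbitrary circuit is brought to this form by padding with identity gates.) -/
def EvenDataLines (V : CliffordCircuit n₀ nₐ) : Prop :=
  ∀ i : Fin n₀, Even (V.tin (Sum.inl i)) ∧ Even (V.tout (Sum.inl i))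

/-- The last time `T`. -/
def depth (V : CliffordCircuit n₀ nₐ) : ℕ := Finset.univ.sup V.tout

/-- The global operator applied between the times `t` and `t + 1`: the tensor product of the gates
of that layer and of the identity on the other wires. -/
noncomputable def layerOp (V : CliffordCircuit n₀ nₐ) (t : ℕ) : QOp (Fin n₀ ⊕ Fin nₐ) :=
  Matrix.of fun a b =>
    (∏ B ∈ (V.layer t).parts, (V.gate t B : QOp B) (fun j => a j) (fun j => b j)) *
      ∏ w ∈ Finset.univ.filter (fun w => ¬ (V.tin w ≤ t ∧ t + 1 ≤ V.tout w)),
        if a w = b w then 1 else 0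

/-- The time slice `E_t` of an error pattern; it is trivial on the wires absent at time `t`. -/
def slice (V : CliffordCircuit n₀ nₐ) (E : V.Location → Pauli) (t : ℕ) :
    Fin n₀ ⊕ Fin nₐ → Pauli :=
  fun w => if h : t ∈ Finset.Icc (V.tin w) (V.tout w) then E ⟨w, t, h⟩ else 0

/-- `evolve E t = E_t U_{t-1/2} E_{t-1} ⋯ U_{1/2} E_0`. -/
noncomputable def evolve (V : CliffordCircuit n₀ nₐ) (E : V.Location → Pauli) :
    ℕ → QOp (Fin n₀ ⊕ Fin nₐ)
  | 0 => pauliOp (V.slice E 0)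
  | t + 1 => pauliOp (V.slice E (t + 1)) * V.layerOp t * V.evolve E t

/-- `I ⊗ |0⟩`: the data wires are free and all ancillas are in the state `|0⟩`. -/
def initOp (n₀ nₐ : ℕ) : Matrix (Basis2 (Fin n₀ ⊕ Fin nₐ)) (Basis2 (Fin n₀)) ℂ :=
  Matrix.of fun a b => if a = Sum.elim b (fun _ => 0) then 1 else 0

/-- The operator `V_E` realized by the circuit in the presence of the error pattern `E`. -/
noncomputable def opWithError (V : CliffordCircuit n₀ nₐ) (E : V.Location → Pauli) :
    QOp (Fin n₀) :=
  (initOp n₀ nₐ).conjTranspose * V.evolve E V.depth * initOp n₀ nₐ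

/-- The operator realized by the circuit without errors. -/
noncomputable def op (V : CliffordCircuit n₀ nₐ) : QOp (Fin n₀) := V.opWithError 0

/-- Good error detection: `V† V` is a nonzero multiple of the orthogonal projector onto the
code space. -/
def IsGoodErrorDetecting (V : CliffordCircuit n₀ nₐ) (C : StabilizerCode n₀) : Prop :=
  ∃ (c : ℂ) (proj : QOp (Fin n₀)), c ≠ 0 ∧ IsStarProjection proj ∧
    LinearMap.range (Matrix.toLin' proj) = C.codeSpace ∧
    V.op.conjTranspose * V.op = c • proj

/-- The error pattern `E` is equivalent to the Pauli error `F` on the data inputs: `V_E = V F` up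
to a phase. -/
def EquivInput (V : CliffordCircuit n₀ nₐ) (E : V.Location → Pauli) (F : Fin n₀ → Pauli) : Prop :=
  ∃ c : ℂ, c ^ 4 = 1 ∧ V.opWithError E = c • (V.op * pauliOp F)

/-- Fault tolerance: an error pattern cannot become equivalent to an input error of higher weight.
That is, every error pattern that does not kill the circuit and that is equivalent to some Pauli
error on the data inputs is equivalent to one of weight at most its own. The middle alternative
covers the patterns that drive the output out of the range of `V`, e.g. a single Pauli error at a
data output that anticommutes with a stabilizer of the output. -/
def IsFaultTolerant (V : CliffordCircuit n₀ nₐ) : Prop :=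
  ∀ E : V.Location → Pauli, V.opWithError E = 0 ∨ (∀ F, ¬ V.EquivInput E F) ∨
    ∃ E' : Fin n₀ → Pauli, V.EquivInput E E' ∧ pauliWeight E' ≤ pauliWeight E

/-- The condition without the middle alternative implies `IsFaultTolerant`. -/
theorem isFaultTolerant_of_strict (V : CliffordCircuit n₀ nₐ)
    (h : ∀ E : V.Location → Pauli, V.opWithError E = 0 ∨
      ∃ E' : Fin n₀ → Pauli, V.EquivInput E E' ∧ pauliWeight E' ≤ pauliWeight E) :
    V.IsFaultTolerant :=
  fun E => (h E).imp_right Or.inr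

/-! ### The localized code -/

theorem mem_layer (V : CliffordCircuit n₀ nₐ) {t : ℕ} {B : Finset (Fin n₀ ⊕ Fin nₐ)}
    (hB : B ∈ (V.layer t).parts) {w : Fin n₀ ⊕ Fin nₐ} (hw : w ∈ B) :
    V.tin w ≤ t ∧ t + 1 ≤ V.tout w :=
  (Finset.mem_filter.mp ((V.layer t).le hB hw)).2

/-- The qubits of the block `B` of layer `t`, at the time `t` just before the layer. -/
def before (V : CliffordCircuit n₀ nₐ) (t : ℕ) {B : Finset (Fin n₀ ⊕ Fin nₐ)}
    (hB : B ∈ (V.layer t).parts) : B ↪ V.Location where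
  toFun j := ⟨j.1, t, Finset.mem_Icc.mpr
    ⟨(V.mem_layer hB j.2).1, (Nat.le_succ t).trans (V.mem_layer hB j.2).2⟩⟩
  inj' _ _ h := Subtype.ext (congrArg Sigma.fst h)

/-- The qubits of the block `B` of layer `t`, at the time `t + 1` just after the layer. -/
def after (V : CliffordCircuit n₀ nₐ) (t : ℕ) {B : Finset (Fin n₀ ⊕ Fin nₐ)}
    (hB : B ∈ (V.layer t).parts) : B ↪ V.Location where
  toFun j := ⟨j.1, t + 1, Finset.mem_Icc.mpr
    ⟨(V.mem_layer hB j.2).1.trans (Nat.le_succ t), (V.mem_layer hB j.2).2⟩⟩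
  inj' _ _ h := Subtype.ext (congrArg Sigma.fst h)

/-- The generators `η_{t+1}(U P U†) η_t(P)` for every gate `U` and every single-qubit `X` or `Z`
operator `P` on one of its wires. -/
def gateGenerators (V : CliffordCircuit n₀ nₐ) : Set (QUnitary V.Location) :=
  {g | ∃ (t : ℕ) (B : Finset (Fin n₀ ⊕ Fin nₐ)) (hB : B ∈ (V.layer t).parts) (j : B) (Q : Pauli),
    (Q = Pauli.X ∨ Q = Pauli.Z) ∧
    g = placeU (V.after t hB) (V.gate t B * pauliU (Pi.single j Q) * (V.gate t B)⁻¹) *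
      placeU (V.before t hB) (pauliU (Pi.single j Q))}

/-- A `Z` at the first location of each ancilla line. -/
def initGenerators (V : CliffordCircuit n₀ nₐ) : Set (QUnitary V.Location) :=
  {g | ∃ j : Fin nₐ, g = pauliU (Pi.single
    (⟨Sum.inr j, V.tin (Sum.inr j), Finset.left_mem_Icc.mpr (V.tin_le_tout _)⟩ : V.Location)
    Pauli.Z)}

/-- A `Z` at the last location of each ancilla line. -/
def postGenerators (V : CliffordCircuit n₀ nₐ) : Set (QUnitary V.Location) :=
  {g | ∃ j : Fin nₐ, g = pauliU (Pi.single
    (⟨Sum.inr j, V.tout (Sum.inr j), Finset.right_mem_Icc.mpr (V.tin_le_tout _)⟩ : V.Location)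
    Pauli.Z)}

/-- The gauge group of the localized subsystem code of the circuit. -/
def gaugeGroup (V : CliffordCircuit n₀ nₐ) : Subgroup (QUnitary V.Location) :=
  Subgroup.closure (V.gateGenerators ∪ V.initGenerators ∪ V.postGenerators)

end CliffordCircuit

/-!
Modulo phases, Pauli operators form a symplectic space over `ZMod 2` (`sympForm`). Let `G` be the
subspace of the gauge group (`gaugeSpace`) and `G^⊥` the subspace of the operators that commute
with it (`bareSpace`). The stabilizers span `G ⊓ G^⊥`, so by double orthogonality the dressed
logical operators are the elements of `G ⊔ G^⊥` outside `G` (`subsystemDistance_eq`). Adding a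
gauge operator to an error pattern `E` changes `V_E` by a phase only
(`opWithError_add_of_mem_gaugeSpace`).

The elements of `G^⊥` are the histories of Pauli operators that evolve through all gates
(`phaseEq_gate_of_mem_bareSpace`), with `I` or `Z` at the ends of the ancilla lines. If such a
history `q` has the input `L` and the output `L'` on the data wires, then
`V_E L = K (-1)^ω(E, q) L' V_E`, where `ω` is the symplectic form and the scalar `K` does not
depend on `E` (`exists_opWithError_mul_eq`). This identity is used twice.
* For `E = 0` it shows that `L` commutes with `V† V`, hence with the stabilizers of `C`.
* If `V_E` equals `V ≠ 0` up to a phase, the comparison of `E` with the trivial pattern shows that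
  `E` is orthogonal to `G^⊥`, that is, that `E` lies in `G` (`mem_gaugeSpace_of_opWithError`).

A history differs by a gauge operator from its own input, placed at the first locations of the data
wires (`add_dataPattern_mem_gaugeSpace`). Indeed, gates preserve the symplectic form, so in the
product of two histories the contributions of the times `2k + 1` and `2k + 2` cancel in
characteristic 2 up to the data lines that begin at the time `2k + 2`; this is where the evenness
of the data lines enters.

Consequently dressed logical operators are equivalent to input errors `L` that are nontrivial
logical operators of `C`, and fault tolerance gives one that is at most as heavy
(`exists_logical_le`). Conversely, a nontrivial logical operator of `C` placed at the data inputs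
is a dressed logical operator of the same weight (`dataPattern_mem_sup`,
`dataPattern_mem_gaugeSpace_iff`).
-/

set_option linter.unusedSectionVars false

/-! ### Pauli matrices as signed permutation matrices -/

/-- The character `z ↦ (-1) ^ z` of `ZMod 2`. -/
noncomputable def zSign (z : ZMod 2) : ℂ := (-1) ^ z.val

@[simp] theorem zSign_zero : zSign 0 = 1 := by simp [zSign]

theorem zSign_one : zSign 1 = -1 := by simp [zSign, ZMod.val_one]

theorem zSign_add (a b : ZMod 2) : zSign (a + b) = zSign a * zSign b := by
  have h : ∀ x : ZMod 2, x = 0 ∨ x = 1 := by decide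
  rcases h a with rfl | rfl <;> rcases h b with rfl | rfl
  · simp
  · simp
  · simp
  · rw [CharTwo.add_self_eq_zero]; simp [zSign_one]

theorem zSign_mul_self (a : ZMod 2) : zSign a * zSign a = 1 := by
  rw [← zSign_add, CharTwo.add_self_eq_zero, zSign_zero]

theorem zSign_ne_zero (a : ZMod 2) : zSign a ≠ 0 := fun h => by
  simpa [h] using zSign_mul_self a

theorem zSign_pow_four (a : ZMod 2) : zSign a ^ 4 = 1 := by
  rw [show zSign a ^ 4 = (zSign a * zSign a) * (zSign a * zSign a) by ring, zSign_mul_self, one_mul]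

theorem zSign_eq_iff {a b : ZMod 2} : zSign a = zSign b ↔ a = b := by
  refine ⟨fun h => ?_, fun h => h ▸ rfl⟩
  have hx : ∀ x : ZMod 2, x = 0 ∨ x = 1 := by decide
  have h1 : (1 : ℂ) ≠ -1 := by norm_num
  rcases hx a with rfl | rfl <;> rcases hx b with rfl | rfl
  · rfl
  · rw [zSign_zero, zSign_one] at h; exact absurd h h1
  · rw [zSign_zero, zSign_one] at h; exact absurd h.symm h1
  · rfl

theorem zSign_sum {ι : Type*} (s : Finset ι) (f : ι → ZMod 2) :
    zSign (∑ i ∈ s, f i) = ∏ i ∈ s, zSign (f i) := by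
  classical
  induction s using Finset.induction_on with
  | empty => simp
  | insert a s ha ih => rw [Finset.sum_insert ha, Finset.prod_insert ha, zSign_add, ih]

/-- The action of the `X`-part of a Pauli matrix on the labels of the computational basis. -/
def Pauli.shift (p : Pauli) (b : Fin 2) : Fin 2 := if p.1 = 0 then b else 1 - b

/-- The sign that the `Z`-part of a Pauli matrix gives to a computational basis vector. -/
noncomputable def Pauli.bitSign (p : Pauli) (b : Fin 2) : ℂ := zSign (if b = 0 then 0 else p.2)

theorem Pauli.shift_shift (p : Pauli) (b : Fin 2) : p.shift (p.shift b) = b := by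
  revert p b; decide

theorem Pauli.eq_shift_comm (p : Pauli) (a b : Fin 2) : a = p.shift b ↔ p.shift a = b := by
  revert p a b; decide

theorem Pauli.shift_add (p q : Pauli) (b : Fin 2) : (p + q).shift b = p.shift (q.shift b) := by
  revert p q b; decide

theorem Pauli.bitSign_mul (p q : Pauli) (b : Fin 2) :
    p.bitSign (q.shift b) * q.bitSign b = zSign (p.2 * q.1) * (p + q).bitSign b := by
  simp only [Pauli.bitSign, ← zSign_add, zSign_eq_iff]
  revert p q b; decide

theorem pauliMatrix_apply (p : Pauli) (i j : Fin 2) :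
    pauliMatrix p i j = if i = p.shift j then p.bitSign j else 0 := by
  have h : ∀ x : ZMod 2, x = 0 ∨ x = 1 := by decide
  obtain ⟨x, z⟩ := p
  have e0 : (0 : ZMod 2).val = 0 := rfl
  have e1 : (1 : ZMod 2).val = 1 := rfl
  rcases h x with rfl | rfl <;> rcases h z with rfl | rfl <;> fin_cases i <;> fin_cases j <;>
    simp [pauliMatrix, Pauli.shift, Pauli.bitSign, zSign, e0, e1]

/-- The action of the `X`-part of a Pauli operator on the labels of the computational basis. -/
def pauliShift {ι : Type} (p : ι → Pauli) (b : Basis2 ι) : Basis2 ι := fun i => (p i).shift (b i)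

/-- The sign that the `Z`-part of a Pauli operator gives to a computational basis vector. -/
noncomputable def pauliSign {ι : Type} [Fintype ι] (p : ι → Pauli) (b : Basis2 ι) : ℂ :=
  ∏ i, (p i).bitSign (b i)

theorem pauliShift_pauliShift {ι : Type} (p : ι → Pauli) (b : Basis2 ι) :
    pauliShift p (pauliShift p b) = b := funext fun i => (p i).shift_shift (b i)

theorem eq_pauliShift_comm {ι : Type} (p : ι → Pauli) (a b : Basis2 ι) :
    a = pauliShift p b ↔ pauliShift p a = b := by
  constructor <;> rintro rfl
  · exact pauliShift_pauliShift p b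
  · exact (pauliShift_pauliShift p a).symm

section

variable {ι : Type} [Fintype ι] [DecidableEq ι]

theorem pauliOp_apply (p : ι → Pauli) (a b : Basis2 ι) :
    pauliOp p a b = if a = pauliShift p b then pauliSign p b else 0 := by
  simp only [pauliOp, tensorOp, Matrix.of_apply, pauliMatrix_apply, pauliSign]
  split_ifs with h
  · subst h
    exact Finset.prod_congr rfl fun i _ => if_pos rfl
  · obtain ⟨i, hi⟩ := Function.ne_iff.mp h
    exact Finset.prod_eq_zero (Finset.mem_univ i) (if_neg hi)

theorem mul_pauliOp_apply {κ : Type} (A : Matrix κ (Basis2 ι) ℂ) (p : ι → Pauli) (a : κ)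
    (b : Basis2 ι) : (A * pauliOp p) a b = A a (pauliShift p b) * pauliSign p b := by
  simp [Matrix.mul_apply, pauliOp_apply]

theorem pauliOp_mul_apply {κ : Type} (A : Matrix (Basis2 ι) κ ℂ) (p : ι → Pauli)
    (a : Basis2 ι) (b : κ) :
    (pauliOp p * A) a b = pauliSign p (pauliShift p a) * A (pauliShift p a) b := by
  simp [Matrix.mul_apply, pauliOp_apply, eq_pauliShift_comm]

theorem pauliMatrix_zero : pauliMatrix 0 = 1 := by
  have e0 : (0 : ZMod 2).val = 0 := rfl
  simp [pauliMatrix, e0]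

theorem pauliOp_zero : pauliOp (0 : ι → Pauli) = 1 := by
  simp only [pauliOp, Pi.zero_apply, pauliMatrix_zero, tensorOp_one]

theorem pauliOp_mul (p q : ι → Pauli) :
    pauliOp p * pauliOp q = zSign (∑ i, (p i).2 * (q i).1) • pauliOp (p + q) := by
  ext a b
  have h : pauliShift (p + q) b = pauliShift p (pauliShift q b) :=
    funext fun i => (p i).shift_add (q i) (b i)
  rw [mul_pauliOp_apply, Matrix.smul_apply, pauliOp_apply, pauliOp_apply, h, smul_eq_mul, mul_ite,
    ite_mul, mul_zero, zero_mul, zSign_sum]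
  simp only [pauliSign, pauliShift, ← Finset.prod_mul_distrib, Pauli.bitSign_mul, Pi.add_apply]

theorem pauli_add_self (p : ι → Pauli) : p + p = 0 :=
  funext fun _ => Prod.ext (CharTwo.add_self_eq_zero _) (CharTwo.add_self_eq_zero _)

theorem pauliOp_mul_self (p : ι → Pauli) :
    pauliOp p * pauliOp p = zSign (∑ i, (p i).2 * (p i).1) • (1 : QOp ι) := by
  rw [pauliOp_mul, pauli_add_self, pauliOp_zero]

theorem pauliOp_ne_zero (p : ι → Pauli) : pauliOp p ≠ 0 := fun h => by
  have := pauliOp_mul_self p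
  rw [h, zero_mul] at this
  exact (smul_ne_zero (zSign_ne_zero _) one_ne_zero) this.symm

theorem trace_pauliOp_zero : (pauliOp (0 : ι → Pauli)).trace ≠ 0 := by
  rw [pauliOp_zero, Matrix.trace_one]
  exact Nat.cast_ne_zero.mpr Fintype.card_ne_zero

theorem trace_pauliOp {p : ι → Pauli} (hp : p ≠ 0) : (pauliOp p).trace = 0 := by
  have h1 : ∀ q : Pauli, q ≠ 0 → (pauliMatrix q).trace = 0 := by
    have h : ∀ x : ZMod 2, x = 0 ∨ x = 1 := by decide
    have e0 : (0 : ZMod 2).val = 0 := rfl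
    have e1 : (1 : ZMod 2).val = 1 := rfl
    rintro ⟨x, z⟩ hq
    rcases h x with rfl | rfl <;> rcases h z with rfl | rfl <;>
      simp [pauliMatrix, e0, e1, Matrix.trace_fin_two] at hq ⊢
  obtain ⟨i, hi⟩ := Function.ne_iff.mp hp
  have h2 : (pauliOp p).trace = ∏ i, (pauliMatrix (p i)).trace := by
    simp only [pauliOp, tensorOp, Matrix.trace, Matrix.diag, Matrix.of_apply]
    rw [Finset.prod_univ_sum, Fintype.piFinset_univ]
  rw [h2]
  exact Finset.prod_eq_zero (Finset.mem_univ i) (h1 _ hi)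

theorem smul_pauliOp_injective {p q : ι → Pauli} {c : ℂ} (h : pauliOp p = c • pauliOp q) :
    p = q := by
  by_contra hne
  have hc : c ≠ 0 := fun hc => pauliOp_ne_zero p (by rw [h, hc, zero_smul])
  have h1 : zSign (∑ i, (p i).2 * (q i).1) • pauliOp (p + q) =
      (c * zSign (∑ i, (q i).2 * (q i).1)) • (1 : QOp ι) := by
    rw [← pauliOp_mul, h, smul_mul_assoc, pauliOp_mul_self, smul_smul]
  have hpq : p + q ≠ 0 := fun h0 => hne (by
    rw [← add_zero p, ← pauli_add_self q, ← add_assoc, h0, zero_add])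
  have h2 := congrArg Matrix.trace h1
  rw [Matrix.trace_smul, Matrix.trace_smul, trace_pauliOp hpq, smul_zero, ← pauliOp_zero] at h2
  exact smul_ne_zero (mul_ne_zero hc (zSign_ne_zero _)) trace_pauliOp_zero h2.symm

/-! ### The symplectic form -/

/-- The symplectic form on Pauli operators modulo phases: it vanishes on a pair of Pauli operators
exactly if they commute. -/
def sympForm : LinearMap.BilinForm (ZMod 2) (ι → Pauli) :=
  LinearMap.mk₂ (ZMod 2) (fun p q => ∑ i, ((p i).1 * (q i).2 + (p i).2 * (q i).1))
    (fun p p' q => by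
      rw [← Finset.sum_add_distrib]
      exact Finset.sum_congr rfl fun i _ => by
        simp only [Pi.add_apply, Prod.fst_add, Prod.snd_add]; ring)
    (fun c p q => by
      rw [smul_eq_mul, Finset.mul_sum]
      exact Finset.sum_congr rfl fun i _ => by
        simp only [Pi.smul_apply, Prod.smul_fst, Prod.smul_snd, smul_eq_mul]; ring)
    (fun p q q' => by
      rw [← Finset.sum_add_distrib]
      exact Finset.sum_congr rfl fun i _ => by
        simp only [Pi.add_apply, Prod.fst_add, Prod.snd_add]; ring)
    (fun c p q => by
      rw [smul_eq_mul, Finset.mul_sum]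
      exact Finset.sum_congr rfl fun i _ => by
        simp only [Pi.smul_apply, Prod.smul_fst, Prod.smul_snd, smul_eq_mul]; ring)

theorem sympForm_apply (p q : ι → Pauli) :
    sympForm p q = ∑ i, ((p i).1 * (q i).2 + (p i).2 * (q i).1) := rfl

theorem sympForm_comm (p q : ι → Pauli) : sympForm p q = sympForm q p := by
  simp only [sympForm_apply]
  exact Finset.sum_congr rfl fun i _ => by ring

theorem sympForm_isRefl : (sympForm (ι := ι)).IsRefl := fun p q h => by
  rw [sympForm_comm]; exact h

theorem sympForm_single (p : ι → Pauli) (i : ι) (q : Pauli) :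
    sympForm p (Pi.single i q) = (p i).1 * q.2 + (p i).2 * q.1 := by
  rw [sympForm_apply, Finset.sum_eq_single i]
  · simp
  · intro j _ hj; simp [Pi.single_eq_of_ne hj]
  · simp

theorem sympForm_single_X (p : ι → Pauli) (i : ι) :
    sympForm p (Pi.single i Pauli.X) = (p i).2 := by
  simp [sympForm_single, Pauli.X]

theorem sympForm_single_Z (p : ι → Pauli) (i : ι) :
    sympForm p (Pi.single i Pauli.Z) = (p i).1 := by
  simp [sympForm_single, Pauli.Z]

theorem eq_of_sympForm_single {p q : ι → Pauli}
    (h : ∀ i Q, Q = Pauli.X ∨ Q = Pauli.Z →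
      sympForm p (Pi.single i Q) = sympForm q (Pi.single i Q)) : p = q := by
  funext i
  have hX := h i _ (Or.inl rfl)
  have hZ := h i _ (Or.inr rfl)
  rw [sympForm_single_X, sympForm_single_X] at hX
  rw [sympForm_single_Z, sympForm_single_Z] at hZ
  exact Prod.ext hZ hX

theorem sympForm_nondegenerate : (sympForm (ι := ι)).Nondegenerate := by
  have h : ∀ p : ι → Pauli, (∀ q, sympForm p q = 0) → p = 0 := fun p hp =>
    eq_of_sympForm_single fun i Q _ => by rw [hp]; simp
  exact ⟨h, fun q hq => h q fun p => by rw [sympForm_comm]; exact hq p⟩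

theorem orthogonal_orthogonal_sympForm (W : Submodule (ZMod 2) (ι → Pauli)) :
    sympForm.orthogonal (sympForm.orthogonal W) = W :=
  LinearMap.BilinForm.orthogonal_orthogonal sympForm_nondegenerate sympForm_isRefl W

theorem mem_orthogonal_sympForm {W : Submodule (ZMod 2) (ι → Pauli)} {p : ι → Pauli} :
    p ∈ sympForm.orthogonal W ↔ ∀ q ∈ W, sympForm p q = 0 := by
  simp only [LinearMap.BilinForm.mem_orthogonal_iff, sympForm_comm p]

theorem orthogonal_inf_orthogonal (W : Submodule (ZMod 2) (ι → Pauli)) :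
    sympForm.orthogonal (W ⊓ sympForm.orthogonal W) = W ⊔ sympForm.orthogonal W := by
  rw [← orthogonal_orthogonal_sympForm (W ⊔ sympForm.orthogonal W)]
  congr 1
  ext p
  simp only [Submodule.mem_inf, mem_orthogonal_sympForm]
  constructor
  · rintro ⟨hp, hp'⟩ q hq
    obtain ⟨a, ha, b, hb, rfl⟩ := Submodule.mem_sup.mp hq
    rw [map_add, hp' a ha, sympForm_comm, mem_orthogonal_sympForm.mp hb p hp, add_zero]
  · intro h
    refine ⟨?_, fun q hq => h q (Submodule.mem_sup_left hq)⟩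
    rw [← orthogonal_orthogonal_sympForm W, mem_orthogonal_sympForm]
    exact fun q hq => h q (Submodule.mem_sup_right hq)

theorem pauliOp_mul_comm (p q : ι → Pauli) :
    pauliOp p * pauliOp q = zSign (sympForm p q) • (pauliOp q * pauliOp p) := by
  rw [pauliOp_mul, pauliOp_mul, smul_smul, ← zSign_add, add_comm q p]
  congr 2
  rw [sympForm_apply, ← Finset.sum_add_distrib]
  refine Finset.sum_congr rfl fun i _ => ?_
  have : (p i).1 * (q i).2 + (q i).2 * (p i).1 = 0 := by
    rw [mul_comm (q i).2]; exact CharTwo.add_self_eq_zero _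
  linear_combination -this

theorem pauliOp_commute_iff (p q : ι → Pauli) :
    pauliOp p * pauliOp q = pauliOp q * pauliOp p ↔ sympForm p q = 0 := by
  have h0 : pauliOp q * pauliOp p ≠ 0 := by
    rw [pauliOp_mul]; exact smul_ne_zero (zSign_ne_zero _) (pauliOp_ne_zero _)
  rw [pauliOp_mul_comm, ← zSign_eq_iff, zSign_zero]
  refine ⟨fun h => smul_left_injective ℂ h0 (by simpa using h), fun h => by rw [h, one_smul]⟩

/-! ### Equality up to a power of `i` -/

/-- Two matrices agree up to a phase that is a power of `i`. -/
def PhaseEq {m n : Type} (A B : Matrix m n ℂ) : Prop := ∃ c : ℂ, c ^ 4 = 1 ∧ A = c • B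

theorem PhaseEq.refl {m n : Type} (A : Matrix m n ℂ) : PhaseEq A A := ⟨1, by simp, by simp⟩

theorem PhaseEq.symm {m n : Type} {A B : Matrix m n ℂ} (h : PhaseEq A B) : PhaseEq B A := by
  obtain ⟨c, hc, rfl⟩ := h
  refine ⟨c⁻¹, by rw [inv_pow, hc, inv_one], ?_⟩
  rw [smul_smul, inv_mul_cancel₀ (fun h0 => by simp [h0] at hc), one_smul]

theorem PhaseEq.trans {m n : Type} {A B D : Matrix m n ℂ} (h : PhaseEq A B) (h' : PhaseEq B D) :
    PhaseEq A D := by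
  obtain ⟨c, hc, rfl⟩ := h
  obtain ⟨c', hc', rfl⟩ := h'
  exact ⟨c * c', by rw [mul_pow, hc, hc', one_mul], smul_smul _ _ _⟩

theorem PhaseEq.mul {l m n : Type} [Fintype m] {A A' : Matrix l m ℂ} {B B' : Matrix m n ℂ}
    (h : PhaseEq A A') (h' : PhaseEq B B') : PhaseEq (A * B) (A' * B') := by
  obtain ⟨c, hc, rfl⟩ := h
  obtain ⟨c', hc', rfl⟩ := h'
  exact ⟨c * c', by rw [mul_pow, hc, hc', one_mul], by
    rw [Matrix.smul_mul, Matrix.mul_smul, smul_smul]⟩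

theorem PhaseEq.of_eq {m n : Type} {A B : Matrix m n ℂ} (h : A = B) : PhaseEq A B :=
  h ▸ PhaseEq.refl A

theorem phaseEq_pauliOp_add (p q : ι → Pauli) :
    PhaseEq (pauliOp (p + q)) (pauliOp p * pauliOp q) :=
  PhaseEq.symm ⟨_, zSign_pow_four _, pauliOp_mul p q⟩

/-! ### Groups of Pauli operators as subspaces of the symplectic space -/

/-- The Pauli operators that lie in `H` up to a scalar, as a subspace of the symplectic space. -/
def pauliSupport (H : Subgroup (QUnitary ι)) : Submodule (ZMod 2) (ι → Pauli) where
  carrier := {p | ∃ g ∈ H, ∃ c : ℂ, pauliOp p = c • (g : QOp ι)}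
  add_mem' := by
    rintro p q ⟨g, hg, c, hc⟩ ⟨g', hg', c', hc'⟩
    obtain ⟨k, -, hk⟩ := phaseEq_pauliOp_add p q
    refine ⟨g * g', H.mul_mem hg hg', k * (c * c'), ?_⟩
    rw [hk, hc, hc', Matrix.smul_mul, Matrix.mul_smul, smul_smul, smul_smul, ← mul_assoc]
    rfl
  zero_mem' := ⟨1, H.one_mem, 1, by rw [pauliOp_zero, one_smul]; rfl⟩
  smul_mem' := by
    have hx : ∀ x : ZMod 2, x = 0 ∨ x = 1 := by decide
    rintro r p h
    rcases hx r with rfl | rfl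
    · rw [zero_smul]
      exact ⟨1, H.one_mem, 1, by rw [pauliOp_zero, one_smul]; rfl⟩
    · rwa [one_smul]

theorem mem_pauliSupport {H : Subgroup (QUnitary ι)} {p : ι → Pauli} :
    p ∈ pauliSupport H ↔ ∃ g ∈ H, ∃ c : ℂ, pauliOp p = c • (g : QOp ι) := Iff.rfl

theorem IsPauli.exists_phaseEq {u : QUnitary ι} (h : IsPauli u) :
    ∃ p, PhaseEq (u : QOp ι) (pauliOp p) := by
  obtain ⟨c, p, hc, h⟩ := h
  exact ⟨p, c, hc, h⟩

theorem isPauli_pauliU (p : ι → Pauli) : IsPauli (pauliU p) := ⟨1, p, by simp, by simp [pauliU]⟩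

theorem PhaseEq.inv {u : QUnitary ι} {p : ι → Pauli} (hp : PhaseEq (u : QOp ι) (pauliOp p)) :
    PhaseEq ((u⁻¹ : QUnitary ι) : QOp ι) (pauliOp p) := by
  have h1 : PhaseEq (u * pauliOp p : QOp ι) 1 :=
    (hp.mul (PhaseEq.refl _)).trans ⟨_, zSign_pow_four _, pauliOp_mul_self p⟩
  have h2 := (PhaseEq.refl ((u⁻¹ : QUnitary ι) : QOp ι)).mul h1
  have h3 : ((u⁻¹ : QUnitary ι) : QOp ι) * u = 1 := congrArg Subtype.val (inv_mul_cancel u)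
  rw [← mul_assoc, h3, one_mul, mul_one] at h2
  exact h2.symm

/-- A Pauli operator commutes with a group of Pauli operators if and only if it is orthogonal to
the subspace of that group. -/
theorem pauliU_mem_centralizer_iff {H : Subgroup (QUnitary ι)} (hH : ∀ g ∈ H, IsPauli g)
    (p : ι → Pauli) :
    pauliU p ∈ Subgroup.centralizer (H : Set (QUnitary ι)) ↔
      p ∈ sympForm.orthogonal (pauliSupport H) := by
  rw [Subgroup.mem_centralizer_iff, mem_orthogonal_sympForm]
  constructor
  · rintro h q ⟨g, hg, c, hc⟩
    have h1 : (g * pauliOp p : QOp ι) = pauliOp p * g := congrArg Subtype.val (h g hg)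
    rw [← pauliOp_commute_iff, hc, Matrix.mul_smul, Matrix.smul_mul, h1]
  · rintro h g hg
    obtain ⟨q, hq⟩ := (hH g hg).exists_phaseEq
    obtain ⟨c', -, hc'⟩ := hq.symm
    obtain ⟨c, -, hc⟩ := hq
    have h1 := (pauliOp_commute_iff p q).mpr (h q ⟨g, hg, c', hc'⟩)
    apply Subtype.ext
    change (g * pauliOp p : QOp ι) = pauliOp p * g
    rw [hc, Matrix.mul_smul, Matrix.smul_mul, h1]

theorem minWeight_centralizer {H : Subgroup (QUnitary ι)} (hH : ∀ g ∈ H, IsPauli g)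
    (B : Subgroup (QUnitary ι)) :
    minWeight (Subgroup.centralizer (H : Set (QUnitary ι))) B =
      ⨅ p ∈ {p | p ∈ sympForm.orthogonal (pauliSupport H) ∧ p ∉ pauliSupport B},
        (pauliWeight p : ℕ∞) := by
  simp only [minWeight, pauliU_mem_centralizer_iff hH, mem_pauliSupport]

/-- The centre of a group of Pauli operators corresponds to the radical of its subspace. -/
theorem pauliSupport_gaugeCenter {G : Subgroup (QUnitary ι)} (hG : ∀ g ∈ G, IsPauli g) :
    pauliSupport (gaugeCenter G) =
      pauliSupport G ⊓ sympForm.orthogonal (pauliSupport G) := by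
  ext p
  constructor
  · rintro ⟨g, hg, c, hc⟩
    refine ⟨⟨g, hg.1, c, hc⟩, (pauliU_mem_centralizer_iff hG p).mp ?_⟩
    refine Subgroup.mem_centralizer_iff.mpr fun h hh => Subtype.ext ?_
    have h1 : (h * g : QOp ι) = g * h :=
      congrArg Subtype.val (Subgroup.mem_centralizer_iff.mp hg.2 h hh)
    change (h * pauliOp p : QOp ι) = pauliOp p * h
    rw [hc, Matrix.mul_smul, Matrix.smul_mul, h1]
  · rintro ⟨⟨g, hg, c, hc⟩, hp⟩
    refine ⟨g, ⟨hg, Subgroup.mem_centralizer_iff.mpr fun h hh => Subtype.ext ?_⟩, c, hc⟩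
    have h1 : (h * pauliOp p : QOp ι) = pauliOp p * h := congrArg Subtype.val
      (Subgroup.mem_centralizer_iff.mp ((pauliU_mem_centralizer_iff hG p).mpr hp) h hh)
    have hc0 : c ≠ 0 := fun h0 => pauliOp_ne_zero p (by rw [hc, h0, zero_smul])
    rw [hc, Matrix.mul_smul, Matrix.smul_mul] at h1
    exact smul_right_injective _ hc0 h1

/-- The distance of a subsystem code in symplectic terms: the dressed logical operators are the sums
of a gauge operator and of an operator that commutes with the gauge group. -/
theorem subsystemDistance_eq {G : Subgroup (QUnitary ι)} (hG : ∀ g ∈ G, IsPauli g) :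
    subsystemDistance G =
      ⨅ p ∈ {p | p ∈ pauliSupport G ⊔ sympForm.orthogonal (pauliSupport G) ∧
        p ∉ pauliSupport G}, (pauliWeight p : ℕ∞) := by
  rw [subsystemDistance,
    minWeight_centralizer (H := gaugeCenter G) (fun g hg => hG g (Subgroup.mem_inf.mp hg).1),
    pauliSupport_gaugeCenter hG, orthogonal_inf_orthogonal]

theorem isPauli_conj {U : QUnitary ι} (hU : IsClifford U) (p : ι → Pauli) :
    ∃ q, PhaseEq (U.1 * pauliOp p) (pauliOp q * U.1) := by
  obtain ⟨c, q, hc, h⟩ := hU _ (isPauli_pauliU p)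
  refine ⟨q, c, hc, ?_⟩
  have h2 : U.1 * pauliOp p = ((U * pauliU p * U⁻¹ * U : QUnitary ι) : QOp ι) := by
    rw [inv_mul_cancel_right]; rfl
  rw [h2]
  change ((U * pauliU p * U⁻¹ : QUnitary ι) : QOp ι) * U.1 = _
  rw [h, Matrix.smul_mul]

end

/-! ### Code space projectors -/

namespace StabilizerCode

variable {n : ℕ} (C : StabilizerCode n)

theorem finite_group : (C.group : Set (QUnitary (Fin n))).Finite := by
  have h4 : {c : ℂ | c ^ 4 = 1}.Finite := by
    refine Set.Finite.subset (Multiset.finite_toSet (Polynomial.nthRoots 4 (1 : ℂ))) fun c hc => ?_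
    exact (Polynomial.mem_nthRoots (by norm_num)).mpr hc
  refine Set.Finite.of_finite_image (f := Subtype.val)
    (((h4.prod (Set.finite_univ (α := Fin n → Pauli))).image
      fun x => x.1 • pauliOp x.2).subset ?_) Subtype.val_injective.injOn
  rintro _ ⟨s, hs, rfl⟩
  obtain ⟨c, p, hc, h⟩ := C.isPauli s hs
  exact ⟨(c, p), ⟨hc, Set.mem_univ _⟩, h.symm⟩

/-- The identity is the only scalar in a stabilizer group. -/
theorem eq_one_of_eq_smul_one {s : QUnitary (Fin n)} (hs : s ∈ C.group) {c : ℂ} (hc : c ^ 4 = 1)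
    (h : (s : QOp (Fin n)) = c • 1) : s = 1 := by
  have hsq : ((s * s : QUnitary (Fin n)) : QOp (Fin n)) = (c ^ 2) • 1 := by
    change (s : QOp (Fin n)) * s = _
    rw [h, Matrix.smul_mul, one_mul, smul_smul, sq]
  have h2 : (c ^ 2) ^ 2 = 1 := by rw [← pow_mul, hc]
  rcases mul_self_eq_one_iff.mp ((sq _).symm.trans h2) with h3 | h3
  · rcases mul_self_eq_one_iff.mp ((sq _).symm.trans h3) with rfl | rfl
    · exact Subtype.ext (by rw [h, one_smul]; rfl)
    · exact absurd (by rw [h, neg_one_smul]) (C.neg_one_notMem s hs)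
  · exact absurd (by rw [hsq, h3, neg_one_smul]) (C.neg_one_notMem _ (C.group.mul_mem hs hs))

theorem pauliSupport_le_orthogonal :
    pauliSupport C.group ≤ sympForm.orthogonal (pauliSupport C.group) := by
  rintro p ⟨g, hg, c, hc⟩
  rw [← pauliU_mem_centralizer_iff C.isPauli, Subgroup.mem_centralizer_iff]
  intro s hs
  apply Subtype.ext
  have h1 : (s * g : QOp (Fin n)) = g * s := congrArg Subtype.val (C.comm s hs g hg)
  change (s * pauliOp p : QOp (Fin n)) = pauliOp p * s
  rw [hc, Matrix.mul_smul, Matrix.smul_mul, h1]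

theorem distance_eq :
    C.distance = ⨅ p ∈ {p | p ∈ sympForm.orthogonal (pauliSupport C.group) ∧
      p ∉ pauliSupport C.group}, (pauliWeight p : ℕ∞) :=
  minWeight_centralizer C.isPauli C.group

variable {C} {proj : QOp (Fin n)}

theorem mul_proj (hr : LinearMap.range (Matrix.toLin' proj) = C.codeSpace)
    {s : QUnitary (Fin n)} (hs : s ∈ C.group) : (s : QOp (Fin n)) * proj = proj := by
  apply Matrix.toLin'.injective
  refine LinearMap.ext fun v => ?_
  have hv : Matrix.toLin' proj v ∈ C.codeSpace := hr ▸ LinearMap.mem_range_self _ v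
  rw [Matrix.toLin'_mul]
  exact hv s hs

theorem proj_mul (hp : IsStarProjection proj)
    (hr : LinearMap.range (Matrix.toLin' proj) = C.codeSpace)
    {s : QUnitary (Fin n)} (hs : s ∈ C.group) : proj * (s : QOp (Fin n)) = proj := by
  have h := congrArg star (mul_proj hr (C.group.inv_mem hs))
  rw [star_mul, hp.isSelfAdjoint.star_eq] at h
  have h2 : star ((s⁻¹ : QUnitary (Fin n)) : QOp (Fin n)) = s := star_star (s : QOp (Fin n))
  rwa [h2] at h

/-- The sum over the stabilizer group is a multiple of the projector onto the code space. -/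
theorem sum_group_eq (hp : IsStarProjection proj)
    (hr : LinearMap.range (Matrix.toLin' proj) = C.codeSpace) :
    ∑ s ∈ C.finite_group.toFinset, (s : QOp (Fin n)) =
      (C.finite_group.toFinset.card : ℂ) • proj := by
  have h1 : proj * ∑ s ∈ C.finite_group.toFinset, (s : QOp (Fin n)) =
      (C.finite_group.toFinset.card : ℂ) • proj := by
    rw [Finset.mul_sum, Finset.sum_congr rfl fun s hs =>
      proj_mul hp hr (C.finite_group.mem_toFinset.mp hs), Finset.sum_const, Nat.cast_smul_eq_nsmul]
  rw [← h1]
  apply Matrix.toLin'.injective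
  refine LinearMap.ext fun v => ?_
  have hv : Matrix.toLin' (∑ s ∈ C.finite_group.toFinset, (s : QOp (Fin n))) v ∈ C.codeSpace := by
    intro g hg
    rw [Matrix.toLin'_apply, Matrix.mulVec_mulVec, Finset.mul_sum]
    congr 1
    refine Finset.sum_bij (fun s _ => g * s) (fun s hs => ?_) (fun s _ s' _ h => ?_)
      (fun s hs => ?_) (fun s _ => rfl)
    · rw [Set.Finite.mem_toFinset] at hs ⊢
      exact C.group.mul_mem hg hs
    · exact mul_left_cancel h
    · rw [Set.Finite.mem_toFinset] at hs
      refine ⟨g⁻¹ * s, ?_, mul_inv_cancel_left g s⟩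
      rw [Set.Finite.mem_toFinset]
      exact C.group.mul_mem (C.group.inv_mem hg) hs
  rw [← hr] at hv
  obtain ⟨w, hw⟩ := hv
  rw [Matrix.toLin'_mul, LinearMap.comp_apply, ← hw, ← LinearMap.comp_apply, ← Matrix.toLin'_mul,
    hp.isIdempotentElem.eq]

/-- The code space is nonzero: only the identity contributes to the trace of the sum over the
stabilizer group. -/
theorem trace_proj_ne_zero (hp : IsStarProjection proj)
    (hr : LinearMap.range (Matrix.toLin' proj) = C.codeSpace) : proj.trace ≠ 0 := by
  intro h0
  have h := congrArg Matrix.trace (sum_group_eq hp hr)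
  rw [Matrix.trace_smul, h0, smul_zero, Matrix.trace_sum, Finset.sum_eq_single 1] at h
  · have h1 : ((1 : QUnitary (Fin n)) : QOp (Fin n)) = pauliOp 0 := pauliOp_zero.symm
    rw [h1] at h
    exact trace_pauliOp_zero h
  · intro s hs hs1
    rw [Set.Finite.mem_toFinset] at hs
    obtain ⟨c, p, hc, hcp⟩ := C.isPauli s hs
    rw [hcp, Matrix.trace_smul, trace_pauliOp, smul_zero]
    rintro rfl
    exact hs1 (C.eq_one_of_eq_smul_one hs hc (by rw [hcp, pauliOp_zero]))
  · intro h1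
    exact absurd (C.finite_group.mem_toFinset.mpr C.group.one_mem) h1

theorem proj_ne_zero (hp : IsStarProjection proj)
    (hr : LinearMap.range (Matrix.toLin' proj) = C.codeSpace) : proj ≠ 0 := fun h =>
  trace_proj_ne_zero hp hr (by rw [h, Matrix.trace_zero])

theorem proj_mul_pauliOp_ne_zero (hp : IsStarProjection proj)
    (hr : LinearMap.range (Matrix.toLin' proj) = C.codeSpace) (q : Fin n → Pauli) :
    proj * pauliOp q ≠ 0 := fun h => by
  have h2 : proj * (pauliOp q * pauliOp q) = 0 := by rw [← mul_assoc, h, zero_mul]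
  rw [pauliOp_mul_self, Matrix.mul_smul, mul_one] at h2
  exact smul_ne_zero (zSign_ne_zero _) (proj_ne_zero hp hr) h2

/-- A Pauli operator that acts on the code space as a scalar is a stabilizer up to a phase:
otherwise its product with the sum over the stabilizer group would have trace zero. -/
theorem mem_pauliSupport_of_proj_mul (hp : IsStarProjection proj)
    (hr : LinearMap.range (Matrix.toLin' proj) = C.codeSpace) {q : Fin n → Pauli} {c : ℂ}
    (h : proj * pauliOp q = c • proj) : q ∈ pauliSupport C.group := by
  by_contra hq
  have hc : c ≠ 0 := fun hc => proj_mul_pauliOp_ne_zero hp hr q (by rw [h, hc, zero_smul])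
  have h1 := congrArg (fun A => (A * pauliOp q).trace) (sum_group_eq hp hr)
  simp only [Finset.sum_mul, Matrix.trace_sum, Matrix.smul_mul, h, Matrix.trace_smul] at h1
  rw [Finset.sum_eq_zero] at h1
  · have hcard : (C.finite_group.toFinset.card : ℂ) ≠ 0 := Nat.cast_ne_zero.mpr
      (Finset.card_ne_zero_of_mem (C.finite_group.mem_toFinset.mpr C.group.one_mem))
    exact smul_ne_zero hcard (smul_ne_zero hc (trace_proj_ne_zero hp hr)) h1.symm
  · intro s hs
    rw [Set.Finite.mem_toFinset] at hs
    obtain ⟨p, hsp⟩ := (C.isPauli s hs).exists_phaseEq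
    obtain ⟨k, -, hk⟩ := (hsp.mul (PhaseEq.refl (pauliOp q))).trans (phaseEq_pauliOp_add p q).symm
    rw [hk, Matrix.trace_smul, trace_pauliOp, smul_zero]
    intro h0
    obtain ⟨k', -, hk'⟩ := hsp.symm
    refine hq ⟨s, hs, k', ?_⟩
    rw [← hk']
    congr 1
    rw [← add_zero q, ← pauli_add_self p, ← add_assoc, add_comm q, h0, zero_add]

theorem exists_proj_mul_eq_smul (hp : IsStarProjection proj)
    (hr : LinearMap.range (Matrix.toLin' proj) = C.codeSpace) {q : Fin n → Pauli}
    (h : q ∈ pauliSupport C.group) : ∃ c : ℂ, c ≠ 0 ∧ proj * pauliOp q = c • proj := by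
  obtain ⟨g, hg, c, hc⟩ := h
  refine ⟨c, fun h0 => pauliOp_ne_zero q (by rw [hc, h0, zero_smul]), ?_⟩
  rw [hc, Matrix.mul_smul, proj_mul hp hr hg]

theorem mem_orthogonal_of_commute_proj (hp : IsStarProjection proj)
    (hr : LinearMap.range (Matrix.toLin' proj) = C.codeSpace) {q : Fin n → Pauli}
    (h : proj * pauliOp q = pauliOp q * proj) :
    q ∈ sympForm.orthogonal (pauliSupport C.group) := by
  rw [mem_orthogonal_sympForm]
  intro v hv
  obtain ⟨c, hc, hcv⟩ := exists_proj_mul_eq_smul hp hr hv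
  have h1 : proj * (pauliOp v * pauliOp q) = c • (proj * pauliOp q) := by
    rw [← mul_assoc, hcv, Matrix.smul_mul]
  have h2 : proj * (pauliOp q * pauliOp v) = c • (proj * pauliOp q) := by
    rw [← mul_assoc, h, mul_assoc, hcv, Matrix.mul_smul]
  rw [pauliOp_mul_comm, Matrix.mul_smul, h1] at h2
  rw [← zSign_eq_iff, zSign_zero]
  exact smul_left_injective ℂ (smul_ne_zero hc (proj_mul_pauliOp_ne_zero hp hr q))
    (by simpa using h2)

end StabilizerCode

namespace CliffordCircuit

variable {n₀ nₐ : ℕ} {C : StabilizerCode n₀} {V : CliffordCircuit n₀ nₐ}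

theorem IsGoodErrorDetecting.op_ne_zero (h : V.IsGoodErrorDetecting C) : V.op ≠ 0 := by
  obtain ⟨c, proj, hc, hp, hr, hV⟩ := h
  intro h0
  rw [h0, Matrix.mul_zero] at hV
  exact smul_ne_zero hc (StabilizerCode.proj_ne_zero hp hr) hV.symm

theorem op_mul_pauliOp_ne_zero (h : V.op ≠ 0) (q : Fin n₀ → Pauli) : V.op * pauliOp q ≠ 0 :=
  fun h0 => by
  have h2 : V.op * (pauliOp q * pauliOp q) = 0 := by rw [← mul_assoc, h0, zero_mul]
  rw [pauliOp_mul_self, Matrix.mul_smul, mul_one] at h2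
  exact smul_ne_zero (zSign_ne_zero _) h h2

open scoped ComplexOrder in
/-- The Pauli errors on the data inputs that a good error-detecting circuit does not see are
the stabilizers. -/
theorem IsGoodErrorDetecting.phaseEq_op_mul_iff (h : V.IsGoodErrorDetecting C)
    (q : Fin n₀ → Pauli) :
    PhaseEq (V.op * pauliOp q) V.op ↔ q ∈ pauliSupport C.group := by
  obtain ⟨c, proj, hc, hp, hr, hV⟩ := h
  constructor
  · rintro ⟨k, -, hk⟩
    refine StabilizerCode.mem_pauliSupport_of_proj_mul hp hr (c := k) ?_
    have h1 : V.op.conjTranspose * V.op * pauliOp q = k • (V.op.conjTranspose * V.op) := by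
      rw [mul_assoc, hk, Matrix.mul_smul]
    rw [hV, Matrix.smul_mul, smul_comm] at h1
    exact smul_right_injective _ hc h1
  · rintro ⟨s, hs, k, hk⟩
    obtain ⟨p, hsp⟩ := (C.isPauli s hs).exists_phaseEq
    obtain rfl : q = p := by
      obtain ⟨k', -, hk'⟩ := hsp
      exact smul_pauliOp_injective (c := k * k') (by rw [hk, hk', smul_smul])
    have h1 : V.op.conjTranspose * (V.op * s - V.op) = 0 := by
      rw [Matrix.mul_sub, ← mul_assoc, hV, Matrix.smul_mul, StabilizerCode.proj_mul hp hr hs,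
        sub_self]
    have h2 : (V.op * s - V.op).conjTranspose * (V.op * s - V.op) = 0 := by
      rw [Matrix.conjTranspose_sub, Matrix.conjTranspose_mul, Matrix.sub_mul, mul_assoc, h1,
        Matrix.mul_zero, sub_zero]
    have h3 : V.op * s = V.op := sub_eq_zero.mp (Matrix.conjTranspose_mul_self_eq_zero.mp h2)
    exact ((PhaseEq.refl V.op).mul hsp.symm).trans (PhaseEq.of_eq h3)

/-- If a Pauli error on the data inputs can be moved to the data outputs, it commutes with
the stabilizers. -/
theorem IsGoodErrorDetecting.mem_orthogonal (h : V.IsGoodErrorDetecting C)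
    {q q' : Fin n₀ → Pauli} (hq : PhaseEq (V.op * pauliOp q) (pauliOp q' * V.op)) :
    q ∈ sympForm.orthogonal (pauliSupport C.group) := by
  obtain ⟨c, proj, hc, hp, hr, hV⟩ := h
  obtain ⟨k, hk4, hk⟩ := hq
  refine StabilizerCode.mem_orthogonal_of_commute_proj hp hr ?_
  have hu : ∀ p : Fin n₀ → Pauli, (pauliOp p).conjTranspose * pauliOp p = 1 := fun p =>
    Matrix.mem_unitaryGroup_iff'.mp (pauliU p).2
  have hu' : ∀ p : Fin n₀ → Pauli, pauliOp p * (pauliOp p).conjTranspose = 1 := fun p =>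
    Matrix.mem_unitaryGroup_iff.mp (pauliU p).2
  -- Since `|k| = 1`, conjugation by `pauliOp q` preserves `V† V`.
  have hk1 : star k * k = 1 := by
    rw [Complex.star_def, Complex.conj_mul', Complex.norm_eq_one_of_pow_eq_one hk4 (by norm_num)]
    norm_num
  have h1 := congrArg (fun A => A.conjTranspose * A) hk
  simp only [Matrix.conjTranspose_mul, Matrix.conjTranspose_smul, Matrix.smul_mul,
    Matrix.mul_smul, smul_smul] at h1
  rw [mul_comm k, hk1, one_smul] at h1
  have h2 : (pauliOp q).conjTranspose * (c • proj) * pauliOp q = c • proj := by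
    rw [← hV]
    calc _ = (pauliOp q).conjTranspose * V.op.conjTranspose * (V.op * pauliOp q) := by
          simp only [mul_assoc]
      _ = V.op.conjTranspose * ((pauliOp q').conjTranspose * pauliOp q') * V.op := by
          rw [h1]; simp only [mul_assoc]
      _ = _ := by rw [hu, mul_one]
  rw [Matrix.mul_smul, Matrix.smul_mul] at h2
  have h3 := smul_right_injective _ hc h2
  calc proj * pauliOp q = (pauliOp q * (pauliOp q).conjTranspose) * (proj * pauliOp q) := by
        rw [hu', one_mul]
    _ = pauliOp q * ((pauliOp q).conjTranspose * proj * pauliOp q) := by simp only [mul_assoc]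
    _ = pauliOp q * proj := congrArg _ h3

end CliffordCircuit

/-! ### Clifford gates act on the symplectic space by isometries -/

section

variable {ι : Type} [Fintype ι] [DecidableEq ι]

theorem sympForm_eq_of_phaseEq {U : QUnitary ι} {a a' b b' : ι → Pauli}
    (ha : PhaseEq (U.1 * pauliOp a) (pauliOp a' * U.1))
    (hb : PhaseEq (U.1 * pauliOp b) (pauliOp b' * U.1)) : sympForm a' b' = sympForm a b := by
  obtain ⟨c, hc, ha⟩ := ha
  obtain ⟨d, hd, hb⟩ := hb
  have hc0 : c ≠ 0 := fun h => by simp [h] at hc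
  have hd0 : d ≠ 0 := fun h => by simp [h] at hd
  have h1 : U.1 * (pauliOp a * pauliOp b) = (c * d) • (pauliOp a' * pauliOp b' * U.1) := by
    rw [← mul_assoc, ha, Matrix.smul_mul, mul_assoc, hb, Matrix.mul_smul, smul_smul, mul_assoc]
  have h2 : U.1 * (pauliOp b * pauliOp a) = (c * d) • (pauliOp b' * pauliOp a' * U.1) := by
    rw [← mul_assoc, hb, Matrix.smul_mul, mul_assoc, ha, Matrix.mul_smul, smul_smul, mul_assoc,
      mul_comm c]
  rw [pauliOp_mul_comm, Matrix.mul_smul, h2, pauliOp_mul_comm a', Matrix.smul_mul,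
    smul_comm (c * d)] at h1
  have h3 : (c * d) • (pauliOp b' * pauliOp a' * U.1) ≠ 0 := by
    refine smul_ne_zero (mul_ne_zero hc0 hd0) fun h0 => ?_
    have h4 : pauliOp b' * pauliOp a' * (U.1 * star U.1) = 0 := by rw [← mul_assoc, h0, zero_mul]
    rw [Matrix.mem_unitaryGroup_iff.mp U.2, mul_one, pauliOp_mul] at h4
    exact smul_ne_zero (zSign_ne_zero _) (pauliOp_ne_zero _) h4
  exact zSign_eq_iff.mp (smul_left_injective ℂ h3 h1).symm

/-- The converse of the fact that a Clifford unitary acts by isometries: if `b` has the same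
commutation relations with the images of the single-qubit operators `X` and `Z` as `a` has with
these operators themselves, then `b` is the image of `a`. -/
theorem phaseEq_of_sympForm_single {U : QUnitary ι} (hU : IsClifford U) {a b : ι → Pauli}
    (h : ∀ i Q, Q = Pauli.X ∨ Q = Pauli.Z → ∀ r,
      PhaseEq (U.1 * pauliOp (Pi.single i Q)) (pauliOp r * U.1) →
      sympForm b r = sympForm a (Pi.single i Q)) :
    PhaseEq (U.1 * pauliOp a) (pauliOp b * U.1) := by
  choose σ hσ using isPauli_conj hU
  have hinj : Function.Injective σ := fun p q hpq => eq_of_sympForm_single fun i Q _ => by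
    rw [← sympForm_eq_of_phaseEq (hσ p) (hσ _), ← sympForm_eq_of_phaseEq (hσ q) (hσ _), hpq]
  obtain ⟨a', rfl⟩ := Finite.injective_iff_surjective.mp hinj b
  obtain rfl : a' = a := eq_of_sympForm_single fun i Q hQ => by
    rw [← h i Q hQ _ (hσ _), sympForm_eq_of_phaseEq (hσ _) (hσ _)]
  exact hσ a'

theorem placeOp_pauliOp {κ : Type} [Fintype κ] (f : κ ↪ ι) (p : κ → Pauli) :
    placeOp f (pauliOp p) = pauliOp (Function.extend f p 0) := by
  classical
  ext a b
  simp only [placeOp, pauliOp, tensorOp, Matrix.of_apply]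
  have hoff : ∀ i, i ∉ Set.range f → pauliMatrix (Function.extend f p 0 i) = 1 := fun i hi => by
    rw [Function.extend_apply' _ _ _ hi, Pi.zero_apply, pauliMatrix_zero]
  split_ifs with h
  · rw [← Finset.prod_subset (Finset.subset_univ (Finset.univ.map f)), Finset.prod_map]
    · simp only [f.injective.extend_apply, Function.comp]
    · intro i _ hi
      have hi' : i ∉ Set.range f := by simpa using hi
      rw [hoff i hi', h i hi', Matrix.one_apply_eq]
  · push Not at h
    obtain ⟨i, hi, hab⟩ := h
    refine (Finset.prod_eq_zero (Finset.mem_univ i) ?_).symm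
    rw [hoff i hi, Matrix.one_apply_ne hab]

theorem placeOp_smul {κ : Type} (f : κ ↪ ι) (c : ℂ) (M : QOp κ) :
    placeOp f (c • M) = c • placeOp f M := by
  classical
  ext a b
  simp [placeOp]

theorem sympForm_extend {κ : Type} [Fintype κ] (f : κ ↪ ι) (q : ι → Pauli) (p : κ → Pauli) :
    sympForm q (Function.extend f p 0) = sympForm (q ∘ f) p := by
  simp only [sympForm_apply]
  rw [← Finset.sum_subset (Finset.subset_univ (Finset.univ.map f)), Finset.sum_map]
  · simp only [f.injective.extend_apply, Function.comp]
  · intro i _ hi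
    have hi' : ¬ ∃ k, f k = i := by simpa using hi
    rw [Function.extend_apply' _ _ _ hi']
    simp

end

theorem Finpartition.prod_eq_prod_parts {α M : Type*} [DecidableEq α] [CommMonoid M]
    {s : Finset α} (P : Finpartition s) (f : α → M) :
    ∏ w ∈ s, f w = ∏ B ∈ P.parts, ∏ w : B, f w := by
  conv_lhs => rw [← P.biUnion_parts, Finset.prod_biUnion P.disjoint]
  exact Finset.prod_congr rfl fun B _ => (Finset.prod_coe_sort B f).symm

theorem Finpartition.sum_eq_sum_parts {α M : Type*} [DecidableEq α] [AddCommMonoid M]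
    {s : Finset α} (P : Finpartition s) (f : α → M) :
    ∑ w ∈ s, f w = ∑ B ∈ P.parts, ∑ w : B, f w := by
  conv_lhs => rw [← P.biUnion_parts, Finset.sum_biUnion P.disjoint]
  exact Finset.sum_congr rfl fun B _ => (Finset.sum_coe_sort B f).symm

namespace CliffordCircuit

variable {n₀ nₐ : ℕ} (V : CliffordCircuit n₀ nₐ)

/-! ### Moving Pauli operators through a circuit -/

theorem pauliSign_eq_prod_layer (t : ℕ) (a : Fin n₀ ⊕ Fin nₐ → Pauli)
    (x : Basis2 (Fin n₀ ⊕ Fin nₐ)) :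
    pauliSign a x = (∏ B ∈ (V.layer t).parts, pauliSign (fun j : B => a j) (fun j => x j)) *
      ∏ w ∈ Finset.univ.filter (fun w => ¬ (V.tin w ≤ t ∧ t + 1 ≤ V.tout w)),
        (a w).bitSign (x w) := by
  rw [pauliSign, ← Finset.prod_filter_mul_prod_filter_not Finset.univ
    (fun w => V.tin w ≤ t ∧ t + 1 ≤ V.tout w), (V.layer t).prod_eq_prod_parts]
  rfl

/-- A Pauli operator moves through a layer if it moves through each of its gates. -/
theorem layerOp_mul_pauliOp {t : ℕ} {a b : Fin n₀ ⊕ Fin nₐ → Pauli}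
    (hB : ∀ B ∈ (V.layer t).parts, PhaseEq ((V.gate t B).1 * pauliOp (fun j : B => a j))
      (pauliOp (fun j : B => b j) * (V.gate t B).1))
    (hoff : ∀ w, ¬ (V.tin w ≤ t ∧ t + 1 ≤ V.tout w) → a w = b w) :
    PhaseEq (V.layerOp t * pauliOp a) (pauliOp b * V.layerOp t) := by
  choose! κ hκ4 hκ using hB
  refine ⟨∏ B ∈ (V.layer t).parts, κ B, ?_, ?_⟩
  · rw [← Finset.prod_pow]
    exact Finset.prod_eq_one hκ4
  ext x y
  rw [mul_pauliOp_apply, Matrix.smul_apply, pauliOp_mul_apply, V.pauliSign_eq_prod_layer t a,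
    V.pauliSign_eq_prod_layer t b, smul_eq_mul, layerOp, Matrix.of_apply, Matrix.of_apply]
  conv_lhs => rw [mul_mul_mul_comm, ← Finset.prod_mul_distrib, ← Finset.prod_mul_distrib]
  conv_rhs => rw [mul_mul_mul_comm, ← mul_assoc, ← Finset.prod_mul_distrib,
    ← Finset.prod_mul_distrib, ← Finset.prod_mul_distrib]
  congr 1
  · refine Finset.prod_congr rfl fun B hB => ?_
    have h := congrFun (congrFun (hκ B hB) (fun j => x j)) (fun j => y j)
    rw [mul_pauliOp_apply, Matrix.smul_apply, pauliOp_mul_apply, smul_eq_mul] at h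
    exact h
  · refine Finset.prod_congr rfl fun w hw => ?_
    change (if x w = (a w).shift (y w) then (1 : ℂ) else 0) * _ =
      (b w).bitSign ((b w).shift (x w)) * (if (b w).shift (x w) = y w then 1 else 0)
    rw [← hoff w (Finset.mem_filter.mp hw).2]
    by_cases h : x w = (a w).shift (y w)
    · rw [if_pos h, if_pos ((Pauli.eq_shift_comm _ _ _).mp h), (Pauli.eq_shift_comm _ _ _).mp h,
        one_mul, mul_one]
    · rw [if_neg h, if_neg (fun h' => h ((Pauli.eq_shift_comm _ _ _).mpr h')), zero_mul, mul_zero]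

/-- Pauli operators on the wires that are absent from a layer commute with that layer. -/
theorem layerOp_mul_pauliOp_of_absent {t : ℕ} {a : Fin n₀ ⊕ Fin nₐ → Pauli}
    (ha : ∀ w, V.tin w ≤ t ∧ t + 1 ≤ V.tout w → a w = 0) :
    PhaseEq (V.layerOp t * pauliOp a) (pauliOp a * V.layerOp t) := by
  refine V.layerOp_mul_pauliOp (fun B hB => ?_) fun _ _ => rfl
  have h0 : (fun j : B => a j) = 0 := funext fun j => ha _ (V.mem_layer hB j.2)
  rw [h0, pauliOp_zero, mul_one, one_mul]
  exact PhaseEq.refl _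

theorem slice_add (E F : V.Location → Pauli) (t : ℕ) :
    V.slice (E + F) t = V.slice E t + V.slice F t := by
  funext w
  simp only [slice, Pi.add_apply]
  split_ifs <;> simp

/-- Comparison of two error patterns: `β t` is the discrepancy that has accumulated by the time `t`,
starting from the operator `c` at the input. -/
theorem evolve_phaseEq {E E' : V.Location → Pauli} {c : Fin n₀ ⊕ Fin nₐ → Pauli}
    {β : ℕ → Fin n₀ ⊕ Fin nₐ → Pauli} (h0 : β 0 + V.slice E 0 = V.slice E' 0 + c)
    (hstep : ∀ t, ∃ b, PhaseEq (V.layerOp t * pauliOp (β t)) (pauliOp b * V.layerOp t) ∧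
      V.slice E' (t + 1) + b = β (t + 1) + V.slice E (t + 1)) (t : ℕ) :
    PhaseEq (V.evolve E' t * pauliOp c) (pauliOp (β t) * V.evolve E t) := by
  induction t with
  | zero => exact (phaseEq_pauliOp_add _ _).symm.trans (h0 ▸ phaseEq_pauliOp_add _ _)
  | succ t ih =>
    obtain ⟨b, hb, hb'⟩ := hstep t
    have h1 : PhaseEq (V.evolve E' (t + 1) * pauliOp c)
        (pauliOp (V.slice E' (t + 1)) * (V.layerOp t * (pauliOp (β t) * V.evolve E t))) := by
      simp only [evolve, mul_assoc]
      exact (PhaseEq.refl _).mul ((PhaseEq.refl _).mul ih)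
    have h2 : PhaseEq
        (pauliOp (V.slice E' (t + 1)) * (V.layerOp t * (pauliOp (β t) * V.evolve E t)))
        (pauliOp (V.slice E' (t + 1)) * pauliOp b * (V.layerOp t * V.evolve E t)) := by
      rw [mul_assoc, ← mul_assoc (pauliOp b), ← mul_assoc (V.layerOp t)]
      exact (PhaseEq.refl _).mul (hb.mul (PhaseEq.refl _))
    refine h1.trans (h2.trans ?_)
    simp only [evolve]
    rw [mul_assoc (pauliOp (V.slice E (t + 1))), ← mul_assoc (pauliOp (β (t + 1)))]
    refine PhaseEq.mul ?_ (PhaseEq.refl _)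
    exact (phaseEq_pauliOp_add _ _).symm.trans (hb' ▸ phaseEq_pauliOp_add _ _)

theorem eq_elim_iff {p : Fin n₀ ⊕ Fin nₐ → Pauli} (hp : ∀ j, (p (Sum.inr j)).1 = 0)
    (x : Basis2 (Fin n₀ ⊕ Fin nₐ)) (y : Basis2 (Fin n₀)) :
    pauliShift p x = Sum.elim y (fun _ => 0) ↔
      x = Sum.elim (pauliShift (p ∘ Sum.inl) y) (fun _ => 0) := by
  rw [← eq_pauliShift_comm]
  have h : pauliShift p (Sum.elim y fun _ => 0) =
      Sum.elim (pauliShift (p ∘ Sum.inl) y) (fun _ => 0) := by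
    funext w
    rcases w with i | j
    · rfl
    · simp [pauliShift, Pauli.shift, hp j]
  rw [h]

theorem pauliSign_elim (p : Fin n₀ ⊕ Fin nₐ → Pauli) (y : Basis2 (Fin n₀)) :
    pauliSign p (Sum.elim y (fun _ => 0)) = pauliSign (p ∘ Sum.inl) y := by
  have h : ∏ j : Fin nₐ, (p (Sum.inr j)).bitSign 0 = 1 :=
    Finset.prod_eq_one fun j _ => by simp [Pauli.bitSign]
  rw [pauliSign, Fintype.prod_sum_type]
  exact (congrArg _ h).trans (mul_one _)

theorem pauliOp_mul_initOp {p : Fin n₀ ⊕ Fin nₐ → Pauli} (hp : ∀ j, (p (Sum.inr j)).1 = 0) :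
    pauliOp p * initOp n₀ nₐ = initOp n₀ nₐ * pauliOp (p ∘ Sum.inl) := by
  ext x y
  rw [pauliOp_mul_apply, mul_pauliOp_apply, initOp, Matrix.of_apply, Matrix.of_apply]
  by_cases h : pauliShift p x = Sum.elim y (fun _ => 0)
  · rw [if_pos h, if_pos ((eq_elim_iff hp x y).mp h), h, pauliSign_elim, mul_one, one_mul]
  · rw [if_neg h, if_neg (mt (eq_elim_iff hp x y).mpr h), mul_zero, zero_mul]

theorem initOp_conjTranspose_mul_pauliOp {p : Fin n₀ ⊕ Fin nₐ → Pauli}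
    (hp : ∀ j, (p (Sum.inr j)).1 = 0) :
    (initOp n₀ nₐ).conjTranspose * pauliOp p =
      pauliOp (p ∘ Sum.inl) * (initOp n₀ nₐ).conjTranspose := by
  ext y x
  rw [pauliOp_mul_apply, mul_pauliOp_apply, initOp, Matrix.conjTranspose_apply,
    Matrix.conjTranspose_apply, Matrix.of_apply, Matrix.of_apply]
  by_cases h : pauliShift p x = Sum.elim y (fun _ => 0)
  · have h' := (eq_elim_iff hp x y).mp h
    rw [if_pos h, if_pos h', h', pauliSign_elim, mul_comm]
  · rw [if_neg h, if_neg (mt (eq_elim_iff hp x y).mpr h), star_zero, zero_mul, mul_zero]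

/-- Comparison of two error patterns that differ by an operator at the data inputs and by
an operator at the data outputs. -/
theorem opWithError_phaseEq {E E' : V.Location → Pauli} {c : Fin n₀ ⊕ Fin nₐ → Pauli}
    {β : ℕ → Fin n₀ ⊕ Fin nₐ → Pauli} (h0 : β 0 + V.slice E 0 = V.slice E' 0 + c)
    (hstep : ∀ t, ∃ b, PhaseEq (V.layerOp t * pauliOp (β t)) (pauliOp b * V.layerOp t) ∧
      V.slice E' (t + 1) + b = β (t + 1) + V.slice E (t + 1))
    (hc : ∀ j, (c (Sum.inr j)).1 = 0) (hβ : ∀ j, (β V.depth (Sum.inr j)).1 = 0) :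
    PhaseEq (V.opWithError E' * pauliOp (c ∘ Sum.inl))
      (pauliOp (β V.depth ∘ Sum.inl) * V.opWithError E) := by
  have h := V.evolve_phaseEq h0 hstep V.depth
  simp only [opWithError]
  rw [Matrix.mul_assoc, ← pauliOp_mul_initOp hc, ← Matrix.mul_assoc, ← Matrix.mul_assoc,
    ← Matrix.mul_assoc, ← initOp_conjTranspose_mul_pauliOp hβ,
    Matrix.mul_assoc _ (V.evolve E' _), Matrix.mul_assoc _ (pauliOp (β _))]
  exact ((PhaseEq.refl _).mul h).mul (PhaseEq.refl _)

theorem tout_le_depth (w : Fin n₀ ⊕ Fin nₐ) : V.tout w ≤ V.depth :=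
  Finset.le_sup (f := V.tout) (Finset.mem_univ w)

theorem sum_location {M : Type*} [AddCommMonoid M] (f : V.Location → M) {N : ℕ}
    (hN : V.depth < N) : ∑ l, f l = ∑ t ∈ Finset.range N, ∑ w,
      if h : t ∈ Finset.Icc (V.tin w) (V.tout w) then f ⟨w, t, h⟩ else 0 := by
  rw [Finset.sum_comm, Fintype.sum_sigma]
  refine Finset.sum_congr rfl fun w _ => ?_
  rw [← Finset.sum_subset (s₁ := Finset.Icc (V.tin w) (V.tout w))]
  · rw [← Finset.sum_coe_sort (Finset.Icc (V.tin w) (V.tout w))]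
    exact Finset.sum_congr rfl fun t _ => by rw [dif_pos t.2]
  · intro t ht
    have h1 := (Finset.mem_Icc.mp ht).2
    have h2 := V.tout_le_depth w
    exact Finset.mem_range.mpr (by omega)
  · intro t _ ht
    exact dif_neg ht

theorem sympForm_eq_sum_slice (p q : V.Location → Pauli) {N : ℕ} (hN : V.depth < N) :
    sympForm p q = ∑ t ∈ Finset.range N, sympForm (V.slice p t) (V.slice q t) := by
  rw [sympForm_apply, V.sum_location _ hN]
  refine Finset.sum_congr rfl fun t _ => ?_
  rw [sympForm_apply]
  refine Finset.sum_congr rfl fun w _ => ?_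
  simp only [slice]
  split_ifs <;> simp

/-- An operator history `β` that is consistent with all layers passes through a circuit with
an error pattern; the sign counts the errors that anticommute with the history. -/
theorem evolve_mul_pauliOp {β : ℕ → Fin n₀ ⊕ Fin nₐ → Pauli} {κ : ℕ → ℂ}
    (hκ : ∀ t, V.layerOp t * pauliOp (β t) = κ t • (pauliOp (β (t + 1)) * V.layerOp t))
    (E : V.Location → Pauli) (t : ℕ) :
    V.evolve E t * pauliOp (β 0) = ((∏ s ∈ Finset.range t, κ s) *
      zSign (∑ s ∈ Finset.range (t + 1), sympForm (V.slice E s) (β s))) •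
        (pauliOp (β t) * V.evolve E t) := by
  induction t with
  | zero =>
    simp only [evolve, Finset.range_zero, Finset.prod_empty, one_mul, zero_add,
      Finset.range_one, Finset.sum_singleton]
    exact pauliOp_mul_comm _ _
  | succ t ih =>
    rw [evolve, mul_assoc, ih, Matrix.mul_smul, Finset.prod_range_succ,
      Finset.sum_range_succ _ (t + 1), zSign_add]
    have h1 : pauliOp (V.slice E (t + 1)) * V.layerOp t * (pauliOp (β t) * V.evolve E t) =
        (κ t * zSign (sympForm (V.slice E (t + 1)) (β (t + 1)))) •
          (pauliOp (β (t + 1)) * (pauliOp (V.slice E (t + 1)) * V.layerOp t * V.evolve E t)) := by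
      rw [mul_assoc, ← mul_assoc (V.layerOp t), hκ, Matrix.smul_mul, Matrix.mul_smul, mul_smul,
        ← mul_assoc, ← mul_assoc, pauliOp_mul_comm]
      simp only [Matrix.smul_mul, mul_assoc]
    rw [h1, smul_smul]
    congr 1
    ring

end CliffordCircuit

namespace CliffordCircuit

variable {n₀ nₐ : ℕ} (V : CliffordCircuit n₀ nₐ)

/-! ### Gauge operators do not change the circuit -/

theorem slice_apply (E : V.Location → Pauli) {t : ℕ} {w : Fin n₀ ⊕ Fin nₐ}
    (h : t ∈ Finset.Icc (V.tin w) (V.tout w)) : V.slice E t w = E ⟨w, t, h⟩ := dif_pos h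

theorem slice_apply_of_notMem (E : V.Location → Pauli) {t : ℕ} {w : Fin n₀ ⊕ Fin nₐ}
    (h : t ∉ Finset.Icc (V.tin w) (V.tout w)) : V.slice E t w = 0 := dif_neg h

theorem slice_single (w : Fin n₀ ⊕ Fin nₐ) (t : ↥(Finset.Icc (V.tin w) (V.tout w))) (Q : Pauli)
    (s : ℕ) : V.slice (Pi.single (⟨w, t⟩ : V.Location) Q) s =
      if s = t then Pi.single w Q else 0 := by
  funext v
  by_cases h : s ∈ Finset.Icc (V.tin v) (V.tout v)
  · rw [slice_apply V _ h]
    by_cases hv : v = w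
    · subst hv
      by_cases hs : s = t
      · obtain rfl : (⟨s, h⟩ : ↥(Finset.Icc (V.tin v) (V.tout v))) = t := Subtype.ext hs
        simp
      · rw [if_neg hs, Pi.single_eq_of_ne, Pi.zero_apply]
        intro h'
        rw [Sigma.mk.injEq] at h'
        exact hs (congrArg Subtype.val (eq_of_heq h'.2))
    · rw [Pi.single_eq_of_ne (fun h' => hv (congrArg Sigma.fst h'))]
      split_ifs
      · rw [Pi.single_eq_of_ne hv]
      · rfl
  · rw [slice_apply_of_notMem V _ h]
    split_ifs with hs
    · rw [Pi.single_eq_of_ne]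
      rintro rfl
      exact h (hs ▸ t.2)
    · rfl

/-- The slices of an operator placed on the qubits of a block. -/
theorem slice_extend {B : Finset (Fin n₀ ⊕ Fin nₐ)} (f : B ↪ V.Location) (t : ℕ)
    (hf : ∀ j, (f j).1 = j ∧ (f j).2.1 = t) (p : B → Pauli) (s : ℕ) :
    V.slice (Function.extend f p 0) s =
      if s = t then Function.extend (Subtype.val : B → Fin n₀ ⊕ Fin nₐ) p 0 else 0 := by
  funext v
  by_cases hex : s = t ∧ v ∈ B
  · obtain ⟨rfl, hv⟩ := hex
    obtain ⟨h1, h2⟩ := hf ⟨v, hv⟩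
    have hm : s ∈ Finset.Icc (V.tin v) (V.tout v) := by
      have := (f ⟨v, hv⟩).2.2
      rwa [h2, h1] at this
    have hfe : f ⟨v, hv⟩ = ⟨v, s, hm⟩ := by
      generalize f ⟨v, hv⟩ = l at h1 h2
      obtain ⟨w, x, hx⟩ := l
      change w = v at h1
      change x = s at h2
      subst h1 h2
      rfl
    rw [slice_apply V _ hm, ← hfe, f.injective.extend_apply, if_pos rfl]
    exact (Subtype.val_injective.extend_apply p 0 (⟨v, hv⟩ : B)).symm
  · have hr : (if s = t then Function.extend (Subtype.val : B → Fin n₀ ⊕ Fin nₐ) p 0 else 0) v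
        = 0 := by
      split_ifs with hs
      · rw [Function.extend_apply', Pi.zero_apply]
        rintro ⟨j, rfl⟩
        exact hex ⟨hs, j.2⟩
      · rfl
    rw [hr]
    by_cases h : s ∈ Finset.Icc (V.tin v) (V.tout v)
    · rw [slice_apply V _ h, Function.extend_apply', Pi.zero_apply]
      rintro ⟨j, hj⟩
      obtain ⟨h1, h2⟩ := hf j
      rw [hj] at h1 h2
      exact hex ⟨h2, by rw [show v = j from h1]; exact j.2⟩
    · exact slice_apply_of_notMem V _ h

/-- The error pattern with the operator `c` at the first locations of all wires. -/
def inputPattern (c : Fin n₀ ⊕ Fin nₐ → Pauli) : V.Location → Pauli :=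
  fun l => if l.2.1 = V.tin l.1 then c l.1 else 0

theorem slice_inputPattern (c : Fin n₀ ⊕ Fin nₐ → Pauli) (t : ℕ) (w : Fin n₀ ⊕ Fin nₐ) :
    V.slice (V.inputPattern c) t w = if t = V.tin w then c w else 0 := by
  by_cases h : t ∈ Finset.Icc (V.tin w) (V.tout w)
  · rw [slice_apply V _ h, inputPattern]
  · rw [slice_apply_of_notMem V _ h, if_neg]
    rintro rfl
    exact h (Finset.left_mem_Icc.mpr (V.tin_le_tout w))

/-- Errors at the first locations act on the data inputs. -/
theorem opWithError_add_inputPattern {c : Fin n₀ ⊕ Fin nₐ → Pauli}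
    (hc : ∀ j, (c (Sum.inr j)).1 = 0) (E : V.Location → Pauli) :
    PhaseEq (V.opWithError E * pauliOp (c ∘ Sum.inl))
      (V.opWithError (E + V.inputPattern c)) := by
  -- The operator `c` waits at each wire until the wire begins.
  have h := V.opWithError_phaseEq (E := E + V.inputPattern c) (E' := E) (c := c)
    (β := fun t w => if t < V.tin w then c w else 0) ?_ (fun t => ?_) hc (fun j => ?_)
  · have h0 : (fun w => if V.depth < V.tin w then c w else 0) ∘ Sum.inl =
        (0 : Fin n₀ → Pauli) := funext fun i => if_neg
      (not_lt.mpr ((V.tin_le_tout _).trans (V.tout_le_depth _)))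
    rwa [h0, pauliOp_zero, one_mul] at h
  · rw [slice_add, add_left_comm]
    congr 1
    funext w
    rw [Pi.add_apply, slice_inputPattern]
    rcases Nat.eq_zero_or_pos (V.tin w) with h | h
    · simp [h]
    · simp [h, h.ne]
  · refine ⟨_, V.layerOp_mul_pauliOp_of_absent fun w hw => if_neg (by omega), ?_⟩
    rw [slice_add, add_left_comm]
    congr 1
    funext w
    rw [Pi.add_apply, slice_inputPattern]
    rcases lt_trichotomy (t + 1) (V.tin w) with h | h | h
    · rw [if_pos (by omega), if_pos h, if_neg h.ne, add_zero]
    · rw [if_pos (by omega), if_neg (by omega), if_pos h, zero_add]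
    · rw [if_neg (by omega), if_neg (by omega), if_neg h.ne', add_zero]
  · rw [if_neg (not_lt.mpr ((V.tin_le_tout _).trans (V.tout_le_depth _)))]
    rfl

theorem opWithError_add_init (j : Fin nₐ) (E : V.Location → Pauli) :
    PhaseEq (V.opWithError (E + Pi.single (⟨Sum.inr j, V.tin (Sum.inr j),
      Finset.left_mem_Icc.mpr (V.tin_le_tout _)⟩ : V.Location) Pauli.Z)) (V.opWithError E) := by
  have hc : ∀ j', ((Pi.single (Sum.inr j) Pauli.Z : Fin n₀ ⊕ Fin nₐ → Pauli)
      (Sum.inr j')).1 = 0 := fun j' => by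
    by_cases h : j' = j
    · subst h; simp [Pauli.Z]
    · rw [Pi.single_eq_of_ne (fun h' => h (Sum.inr.inj h'))]; rfl
  have h := V.opWithError_add_inputPattern hc E
  have h0 : (Pi.single (Sum.inr j) Pauli.Z : Fin n₀ ⊕ Fin nₐ → Pauli) ∘ Sum.inl = 0 :=
    funext fun i => by simp
  rw [h0, pauliOp_zero, mul_one] at h
  convert h.symm using 3
  funext l
  by_cases hl : l = ⟨Sum.inr j, V.tin (Sum.inr j), Finset.left_mem_Icc.mpr (V.tin_le_tout _)⟩
  · subst hl; simp [inputPattern]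
  · rw [Pi.single_eq_of_ne hl, inputPattern]
    split_ifs with h1
    · rw [Pi.single_eq_of_ne]
      rintro h2
      obtain ⟨w, t, ht⟩ := l
      change w = _ at h2
      subst h2
      exact hl (Sigma.ext rfl (heq_of_eq (Subtype.ext h1)))
    · rfl

theorem opWithError_add_post (j : Fin nₐ) (E : V.Location → Pauli) :
    PhaseEq (V.opWithError (E + Pi.single (⟨Sum.inr j, V.tout (Sum.inr j),
      Finset.right_mem_Icc.mpr (V.tin_le_tout _)⟩ : V.Location) Pauli.Z)) (V.opWithError E) := by
  set F : V.Location → Pauli := Pi.single (⟨Sum.inr j, V.tout (Sum.inr j),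
      Finset.right_mem_Icc.mpr (V.tin_le_tout _)⟩ : V.Location) Pauli.Z with hF
  have hs : ∀ t, V.slice F t =
      if t = V.tout (Sum.inr j) then Pi.single (Sum.inr j) Pauli.Z else 0 :=
    V.slice_single _ _ _
  -- After the line has ended, the extra `Z` stays there until it meets `⟨0|`.
  have h := V.opWithError_phaseEq (E := E) (E' := E + F) (c := 0)
    (β := fun t => if V.tout (Sum.inr j) ≤ t then Pi.single (Sum.inr j) Pauli.Z else 0)
    ?_ (fun t => ?_) (fun _ => rfl) (fun j' => ?_)
  · have h0 : (if V.tout (Sum.inr j) ≤ V.depth then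
        (Pi.single (Sum.inr j) Pauli.Z : Fin n₀ ⊕ Fin nₐ → Pauli) else 0) ∘ Sum.inl = 0 := by
      rw [if_pos (V.tout_le_depth _)]
      exact funext fun i => by simp
    have h1 : (0 : Fin n₀ ⊕ Fin nₐ → Pauli) ∘ Sum.inl = 0 := rfl
    rwa [h0, h1, pauliOp_zero, mul_one, one_mul] at h
  · rw [slice_add, hs, add_zero, add_comm]
    congr 1
    by_cases h : V.tout (Sum.inr j) = 0
    · simp [h]
    · rw [if_neg (by omega), if_neg (by omega)]
  · refine ⟨_, V.layerOp_mul_pauliOp_of_absent fun w hw => ?_, ?_⟩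
    · split_ifs with h
      · rw [Pi.single_eq_of_ne]
        rintro rfl
        omega
      · rfl
    · rw [slice_add, hs, add_comm (_ + _), add_left_comm, add_comm (ite _ _ _) (V.slice E _)]
      congr 1
      rcases lt_trichotomy (t + 1) (V.tout (Sum.inr j)) with h | h | h
      · rw [if_neg (by omega), if_neg (by omega), if_neg (by omega), add_zero]
      · rw [if_neg (by omega), if_pos h, if_pos h.ge, zero_add]
      · rw [if_pos (by omega), if_neg (by omega), if_pos h.le, add_zero]
  · rw [if_pos (V.tout_le_depth _)]
    by_cases h : j' = j
    · subst h; simp [Pauli.Z]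
    · rw [Pi.single_eq_of_ne (fun h' => h (Sum.inr.inj h'))]; rfl

/-- The pattern of a gauge generator `η_{t+1}(U P U†) η_t(P)`, for `P` with the label `p` and
`U P U†` with the label `r`. -/
noncomputable def gatePattern {t : ℕ} {B : Finset (Fin n₀ ⊕ Fin nₐ)}
    (hB : B ∈ (V.layer t).parts) (p r : B → Pauli) : V.Location → Pauli :=
  Function.extend (V.after t hB) r 0 + Function.extend (V.before t hB) p 0

theorem slice_gatePattern {t : ℕ} {B : Finset (Fin n₀ ⊕ Fin nₐ)}
    (hB : B ∈ (V.layer t).parts) (p r : B → Pauli) (s : ℕ) :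
    V.slice (V.gatePattern hB p r) s =
      (if s = t + 1 then Function.extend (Subtype.val : B → Fin n₀ ⊕ Fin nₐ) r 0 else 0) +
        if s = t then Function.extend (Subtype.val : B → Fin n₀ ⊕ Fin nₐ) p 0 else 0 := by
  rw [gatePattern, slice_add, V.slice_extend (V.after t hB) (t + 1) fun _ => ⟨rfl, rfl⟩,
    V.slice_extend (V.before t hB) t fun _ => ⟨rfl, rfl⟩]

theorem layerOp_mul_extend {t : ℕ} {B : Finset (Fin n₀ ⊕ Fin nₐ)}
    (hB : B ∈ (V.layer t).parts) {p r : B → Pauli}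
    (h : PhaseEq ((V.gate t B).1 * pauliOp p) (pauliOp r * (V.gate t B).1)) :
    PhaseEq (V.layerOp t * pauliOp (Function.extend (Subtype.val : B → Fin n₀ ⊕ Fin nₐ) p 0))
      (pauliOp (Function.extend (Subtype.val : B → Fin n₀ ⊕ Fin nₐ) r 0) * V.layerOp t) := by
  refine V.layerOp_mul_pauliOp (fun B' hB' => ?_) fun w hw => ?_
  · by_cases hBB : B' = B
    · subst hBB
      simpa only [Subtype.val_injective.extend_apply] using h
    · have h0 : ∀ q : B → Pauli,
          (fun j : B' => Function.extend (Subtype.val : B → Fin n₀ ⊕ Fin nₐ) q 0 j) = 0 :=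
        fun q => funext fun j => by
          rw [Function.extend_apply']
          · rfl
          · rintro ⟨k, hk⟩
            exact Finset.disjoint_left.mp ((V.layer t).disjoint hB' hB hBB) j.2 (hk ▸ k.2)
      rw [h0, h0, pauliOp_zero, mul_one, one_mul]
      exact PhaseEq.refl _
  · have hw' : ¬ ∃ j : B, (j : Fin n₀ ⊕ Fin nₐ) = w := by
      rintro ⟨j, rfl⟩
      exact hw (V.mem_layer hB j.2)
    rw [Function.extend_apply' _ _ _ hw', Function.extend_apply' _ _ _ hw']

theorem opWithError_add_gatePattern {t : ℕ} {B : Finset (Fin n₀ ⊕ Fin nₐ)}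
    (hB : B ∈ (V.layer t).parts) {p r : B → Pauli}
    (h : PhaseEq ((V.gate t B).1 * pauliOp p) (pauliOp r * (V.gate t B).1))
    (E : V.Location → Pauli) :
    PhaseEq (V.opWithError (E + V.gatePattern hB p r)) (V.opWithError E) := by
  have ht : t < V.depth := by
    obtain ⟨w, hw⟩ := (V.layer t).nonempty_of_mem_parts hB
    exact (V.mem_layer hB hw).2.trans (V.tout_le_depth w)
  -- The patterns differ between the times `t` and `t + 1` only, where the gate maps `p` to `r`.
  have h := V.opWithError_phaseEq (E := E) (E' := E + V.gatePattern hB p r) (c := 0)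
    (β := fun s => if s = t then Function.extend (Subtype.val : B → Fin n₀ ⊕ Fin nₐ) p 0 else 0)
    ?_ (fun s => ?_) (fun _ => rfl) (fun j' => ?_)
  · have h1 : (0 : Fin n₀ ⊕ Fin nₐ → Pauli) ∘ Sum.inl = 0 := rfl
    simpa only [if_neg ht.ne', h1, pauliOp_zero, mul_one, one_mul] using h
  · rw [slice_add, slice_gatePattern, add_zero, if_neg (Nat.succ_ne_zero t).symm, zero_add,
      add_comm]
  · by_cases hs : s = t
    · subst hs
      refine ⟨_, by simpa only [if_true] using V.layerOp_mul_extend hB h, ?_⟩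
      rw [slice_add, slice_gatePattern, if_pos rfl, if_neg (Nat.succ_ne_self s), add_zero,
        zero_add, add_assoc, pauli_add_self, add_zero]
    · refine ⟨0, ?_, ?_⟩
      · simp only [if_neg hs, pauliOp_zero, mul_one, one_mul]
        exact PhaseEq.refl _
      · rw [slice_add, slice_gatePattern, if_neg (fun h => hs (Nat.succ_injective h)), zero_add,
          add_zero, add_comm]
  · simp only [if_neg ht.ne']
    rfl

theorem gateGenerator_phaseEq {t : ℕ} {B : Finset (Fin n₀ ⊕ Fin nₐ)}
    (hB : B ∈ (V.layer t).parts) {p r : B → Pauli}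
    (h : PhaseEq ((V.gate t B).1 * pauliOp p) (pauliOp r * (V.gate t B).1)) :
    PhaseEq (placeU (V.after t hB) (V.gate t B * pauliU p * (V.gate t B)⁻¹) *
      placeU (V.before t hB) (pauliU p) : QUnitary V.Location).1
      (pauliOp (V.gatePattern hB p r)) := by
  obtain ⟨c, hc, h⟩ := h
  refine PhaseEq.trans ⟨c, hc, ?_⟩ (phaseEq_pauliOp_add _ _).symm
  have h1 : (V.gate t B * pauliU p * (V.gate t B)⁻¹ : QUnitary B).1 = c • pauliOp r := by
    change (V.gate t B).1 * pauliOp p * star (V.gate t B).1 = _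
    rw [h, Matrix.smul_mul, mul_assoc, Matrix.mem_unitaryGroup_iff.mp (V.gate t B).2, mul_one]
  change placeOp (V.after t hB) (V.gate t B * pauliU p * (V.gate t B)⁻¹ : QUnitary B).1 *
    placeOp (V.before t hB) (pauliOp p) = _
  rw [h1, placeOp_smul, placeOp_pauliOp, placeOp_pauliOp, Matrix.smul_mul]

/-- Every gauge operator is a Pauli operator, and it does not change the circuit when it is added
to an error pattern. -/
theorem exists_phaseEq_of_mem_gaugeGroup {g : QUnitary V.Location} (hg : g ∈ V.gaugeGroup) :
    ∃ p, PhaseEq g.1 (pauliOp p) ∧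
      ∀ E, PhaseEq (V.opWithError (E + p)) (V.opWithError E) := by
  induction hg using Subgroup.closure_induction with
  | mem g hg =>
    rcases hg with (⟨t, B, hB, j, Q, -, rfl⟩ | ⟨j, rfl⟩) | ⟨j, rfl⟩
    · obtain ⟨r, hr⟩ := isPauli_conj (V.isClifford t B hB) (Pi.single j Q)
      exact ⟨_, V.gateGenerator_phaseEq hB hr, V.opWithError_add_gatePattern hB hr⟩
    · exact ⟨_, PhaseEq.refl _, V.opWithError_add_init j⟩
    · exact ⟨_, PhaseEq.refl _, V.opWithError_add_post j⟩
  | one =>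
    refine ⟨0, PhaseEq.of_eq pauliOp_zero.symm, fun E => ?_⟩
    rw [add_zero]
    exact PhaseEq.refl _
  | mul g h _ _ hg hh =>
    obtain ⟨p, hp, hp'⟩ := hg
    obtain ⟨q, hq, hq'⟩ := hh
    refine ⟨p + q, (hp.mul hq).trans (phaseEq_pauliOp_add p q).symm, fun E => ?_⟩
    rw [← add_assoc]
    exact (hq' _).trans (hp' E)
  | inv g _ hg =>
    obtain ⟨p, hp, hp'⟩ := hg
    exact ⟨p, hp.inv, hp'⟩

theorem isPauli_of_mem_gaugeGroup {g : QUnitary V.Location} (hg : g ∈ V.gaugeGroup) :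
    IsPauli g := by
  obtain ⟨p, ⟨c, hc, h⟩, -⟩ := V.exists_phaseEq_of_mem_gaugeGroup hg
  exact ⟨c, p, hc, h⟩

/-- The gauge operators as a subspace of the symplectic space of all error patterns. -/
def gaugeSpace : Submodule (ZMod 2) (V.Location → Pauli) := pauliSupport V.gaugeGroup

theorem opWithError_add_of_mem_gaugeSpace {p : V.Location → Pauli} (hp : p ∈ V.gaugeSpace)
    (E : V.Location → Pauli) : PhaseEq (V.opWithError (E + p)) (V.opWithError E) := by
  obtain ⟨g, hg, c, hc⟩ := hp
  obtain ⟨q, ⟨k, -, hk⟩, hq⟩ := V.exists_phaseEq_of_mem_gaugeGroup hg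
  obtain rfl : p = q := smul_pauliOp_injective (c := c * k) (by rw [hc, hk, smul_smul])
  exact hq E

theorem mem_gaugeSpace_of_phaseEq {g : QUnitary V.Location} (hg : g ∈ V.gaugeGroup)
    {p : V.Location → Pauli} (h : PhaseEq g.1 (pauliOp p)) : p ∈ V.gaugeSpace := by
  obtain ⟨c, -, hc⟩ := h.symm
  exact ⟨g, hg, c, hc⟩

theorem gatePattern_mem_gaugeSpace {t : ℕ} {B : Finset (Fin n₀ ⊕ Fin nₐ)}
    (hB : B ∈ (V.layer t).parts) {j : B} {Q : Pauli} (hQ : Q = Pauli.X ∨ Q = Pauli.Z)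
    {r : B → Pauli}
    (h : PhaseEq ((V.gate t B).1 * pauliOp (Pi.single j Q)) (pauliOp r * (V.gate t B).1)) :
    V.gatePattern hB (Pi.single j Q) r ∈ V.gaugeSpace :=
  V.mem_gaugeSpace_of_phaseEq
    (Subgroup.subset_closure (Or.inl (Or.inl ⟨t, B, hB, j, Q, hQ, rfl⟩)))
    (V.gateGenerator_phaseEq hB h)

theorem init_mem_gaugeSpace (j : Fin nₐ) :
    (Pi.single (⟨Sum.inr j, V.tin (Sum.inr j), Finset.left_mem_Icc.mpr (V.tin_le_tout _)⟩ :
      V.Location) Pauli.Z : V.Location → Pauli) ∈ V.gaugeSpace :=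
  V.mem_gaugeSpace_of_phaseEq (Subgroup.subset_closure (Or.inl (Or.inr ⟨j, rfl⟩)))
    (PhaseEq.refl _)

theorem post_mem_gaugeSpace (j : Fin nₐ) :
    (Pi.single (⟨Sum.inr j, V.tout (Sum.inr j), Finset.right_mem_Icc.mpr (V.tin_le_tout _)⟩ :
      V.Location) Pauli.Z : V.Location → Pauli) ∈ V.gaugeSpace :=
  V.mem_gaugeSpace_of_phaseEq (Subgroup.subset_closure (Or.inr ⟨j, rfl⟩))
    (PhaseEq.refl _)

end CliffordCircuit

namespace CliffordCircuit

variable {n₀ nₐ : ℕ} (V : CliffordCircuit n₀ nₐ)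

/-! ### Operators that commute with the gauge group -/

/-- The Pauli operators that commute with the gauge group. They are the histories of a Pauli
operator that evolves through the circuit, with `I` or `Z` at both ends of each ancilla line. -/
def bareSpace : Submodule (ZMod 2) (V.Location → Pauli) := sympForm.orthogonal V.gaugeSpace

variable {V}

theorem orthogonal_bareSpace : sympForm.orthogonal V.bareSpace = V.gaugeSpace :=
  orthogonal_orthogonal_sympForm _

theorem phaseEq_gate_of_mem_bareSpace {q : V.Location → Pauli} (hq : q ∈ V.bareSpace) {t : ℕ}
    {B : Finset (Fin n₀ ⊕ Fin nₐ)} (hB : B ∈ (V.layer t).parts) :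
    PhaseEq ((V.gate t B).1 * pauliOp (q ∘ V.before t hB))
      (pauliOp (q ∘ V.after t hB) * (V.gate t B).1) := by
  refine phaseEq_of_sympForm_single (V.isClifford t B hB) fun j Q hQ r hr => ?_
  have h := mem_orthogonal_sympForm.mp hq _ (V.gatePattern_mem_gaugeSpace hB hQ hr)
  rw [gatePattern, map_add, sympForm_extend, sympForm_extend] at h
  exact CharTwo.add_eq_zero.mp h

theorem fst_at_tin_eq_zero {q : V.Location → Pauli} (hq : q ∈ V.bareSpace) (j : Fin nₐ) :
    (q ⟨Sum.inr j, V.tin (Sum.inr j), Finset.left_mem_Icc.mpr (V.tin_le_tout _)⟩).1 = 0 := by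
  rw [← sympForm_single_Z]
  exact mem_orthogonal_sympForm.mp hq _ (V.init_mem_gaugeSpace j)

theorem fst_at_tout_eq_zero {q : V.Location → Pauli} (hq : q ∈ V.bareSpace) (j : Fin nₐ) :
    (q ⟨Sum.inr j, V.tout (Sum.inr j), Finset.right_mem_Icc.mpr (V.tin_le_tout _)⟩).1 = 0 := by
  rw [← sympForm_single_Z]
  exact mem_orthogonal_sympForm.mp hq _ (V.post_mem_gaugeSpace j)

variable (V)

/-- The location of the wire `w` that is nearest to the time `t`. -/
def nearest (w : Fin n₀ ⊕ Fin nₐ) (t : ℕ) : V.Location :=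
  ⟨w, max (V.tin w) (min t (V.tout w)), Finset.mem_Icc.mpr
    ⟨le_max_left _ _, max_le (V.tin_le_tout w) (min_le_right _ _)⟩⟩

variable {V}

theorem nearest_eq {w : Fin n₀ ⊕ Fin nₐ} {s t : ℕ} (h : s ∈ Finset.Icc (V.tin w) (V.tout w))
    (hs : max (V.tin w) (min t (V.tout w)) = s) : V.nearest w t = ⟨w, s, h⟩ :=
  Sigma.ext rfl (heq_of_eq (Subtype.ext hs))

/-- The restriction of a pattern to the data inputs. -/
def atInputs (q : V.Location → Pauli) : Fin n₀ → Pauli := fun i =>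
  q ⟨Sum.inl i, V.tin (Sum.inl i), Finset.left_mem_Icc.mpr (V.tin_le_tout _)⟩

/-- The restriction of a pattern to the data outputs. -/
def atOutputs (q : V.Location → Pauli) : Fin n₀ → Pauli := fun i =>
  q ⟨Sum.inl i, V.tout (Sum.inl i), Finset.right_mem_Icc.mpr (V.tin_le_tout _)⟩

/-- An operator that commutes with the gauge group carries its data input to its data output, and
an error pattern contributes the sign of its commutation relation with that operator. -/
theorem exists_opWithError_mul_eq {q : V.Location → Pauli} (hq : q ∈ V.bareSpace) :
    ∃ K : ℂ, K ^ 4 = 1 ∧ ∀ E : V.Location → Pauli,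
      V.opWithError E * pauliOp (atInputs q) =
        (K * zSign (sympForm E q)) • (pauliOp (atOutputs q) * V.opWithError E) := by
  -- The history is continued constantly along each wire before its first and after its last time.
  set β : ℕ → Fin n₀ ⊕ Fin nₐ → Pauli := fun t w => q (V.nearest w t)
  have hstep : ∀ t, PhaseEq (V.layerOp t * pauliOp (β t)) (pauliOp (β (t + 1)) * V.layerOp t) := by
    intro t
    refine V.layerOp_mul_pauliOp (fun B hB => ?_) fun w hw => ?_
    · have h1 : (fun j : B => β t j) = q ∘ V.before t hB := funext fun j =>
        congrArg q (nearest_eq _ (by have := V.mem_layer hB j.2; omega))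
      have h2 : (fun j : B => β (t + 1) j) = q ∘ V.after t hB := funext fun j =>
        congrArg q (nearest_eq _ (by have := V.mem_layer hB j.2; omega))
      rw [h1, h2]
      exact phaseEq_gate_of_mem_bareSpace hq hB
    · exact congrArg q (nearest_eq _ (by have := V.tin_le_tout w; omega))
  choose κ hκ4 hκ using hstep
  have hin : ∀ w, β 0 w = q ⟨w, V.tin w, Finset.left_mem_Icc.mpr (V.tin_le_tout w)⟩ := fun w =>
    congrArg q (nearest_eq _ (by omega))
  have hout : ∀ w, β V.depth w = q ⟨w, V.tout w, Finset.right_mem_Icc.mpr (V.tin_le_tout w)⟩ :=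
    fun w => congrArg q (nearest_eq _ (by
      have := V.tin_le_tout w
      have := V.tout_le_depth w
      omega))
  have h0 : ∀ j, (β 0 (Sum.inr j)).1 = 0 := fun j => by rw [hin]; exact fst_at_tin_eq_zero hq j
  have h1 : ∀ j, (β V.depth (Sum.inr j)).1 = 0 := fun j => by
    rw [hout]; exact fst_at_tout_eq_zero hq j
  refine ⟨∏ s ∈ Finset.range V.depth, κ s, ?_, fun E => ?_⟩
  · rw [← Finset.prod_pow]
    exact Finset.prod_eq_one fun s _ => hκ4 s
  have hE : sympForm E q =
      ∑ s ∈ Finset.range (V.depth + 1), sympForm (V.slice E s) (β s) := by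
    rw [V.sympForm_eq_sum_slice E q (Nat.lt_succ_self _)]
    refine Finset.sum_congr rfl fun s _ => ?_
    rw [sympForm_apply, sympForm_apply]
    refine Finset.sum_congr rfl fun w _ => ?_
    by_cases h : s ∈ Finset.Icc (V.tin w) (V.tout w)
    · have h2 : β s w = V.slice q s w := by
        rw [slice_apply V _ h]
        exact congrArg q (nearest_eq h (by have := Finset.mem_Icc.mp h; omega))
      rw [h2]
    · rw [slice_apply_of_notMem V E h]
      simp
  have h := V.evolve_mul_pauliOp hκ E V.depth
  rw [← hE] at h
  have e0 : atInputs q = β 0 ∘ Sum.inl := funext fun i => (hin _).symm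
  have e1 : atOutputs q = β V.depth ∘ Sum.inl := funext fun i => (hout _).symm
  simp only [opWithError]
  rw [e0, e1, Matrix.mul_assoc, ← pauliOp_mul_initOp h0, ← Matrix.mul_assoc, ← Matrix.mul_assoc,
    ← Matrix.mul_assoc, ← initOp_conjTranspose_mul_pauliOp h1,
    Matrix.mul_assoc _ (V.evolve E _), h, Matrix.mul_smul, Matrix.smul_mul,
    Matrix.mul_assoc _ (pauliOp _)]

theorem phaseEq_op_mul_atInputs {q : V.Location → Pauli} (hq : q ∈ V.bareSpace) :
    PhaseEq (V.op * pauliOp (atInputs q)) (pauliOp (atOutputs q) * V.op) := by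
  obtain ⟨K, hK, h⟩ := exists_opWithError_mul_eq hq
  refine ⟨K, hK, ?_⟩
  have := h 0
  rwa [LinearMap.map_zero, LinearMap.zero_apply, zSign_zero, mul_one] at this

/-- An error pattern that acts trivially on the circuit is a gauge operator: if it anticommuted with
an operator that commutes with the gauge group, that operator would move from the data inputs
to the data outputs with two opposite signs. -/
theorem mem_gaugeSpace_of_opWithError (hV : V.op ≠ 0) {p : V.Location → Pauli}
    (hp : PhaseEq (V.opWithError p) V.op) : p ∈ V.gaugeSpace := by
  rw [← orthogonal_bareSpace, mem_orthogonal_sympForm]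
  intro q hq
  obtain ⟨K, hK, h⟩ := exists_opWithError_mul_eq hq
  obtain ⟨c, hc, hcp⟩ := hp
  have hc0 : c ≠ 0 := fun h => by simp [h] at hc
  have h1 := h p
  have h2 : V.op * pauliOp (atInputs q) = K • (pauliOp (atOutputs q) * V.op) := by
    have := h 0
    rwa [LinearMap.map_zero, LinearMap.zero_apply, zSign_zero, mul_one] at this
  rw [hcp, Matrix.smul_mul, Matrix.mul_smul, smul_comm _ c] at h1
  have h3 := smul_right_injective _ hc0 h1
  simp only [mul_comm K] at h3
  rw [mul_smul, ← h2] at h3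
  rw [← zSign_eq_iff, zSign_zero]
  exact smul_left_injective ℂ (op_mul_pauliOp_ne_zero hV (atInputs q)) (by simpa using h3.symm)

/-! ### Patterns supported on the data inputs -/

variable (V)

/-- The error pattern that consists of a Pauli error on the data inputs. -/
def dataPattern (L : Fin n₀ → Pauli) : V.Location → Pauli :=
  V.inputPattern (Sum.elim L (fun _ => 0))

theorem opWithError_dataPattern (L : Fin n₀ → Pauli) :
    PhaseEq (V.op * pauliOp L) (V.opWithError (V.dataPattern L)) := by
  have h := V.opWithError_add_inputPattern (c := Sum.elim L (fun _ => 0)) (fun _ => rfl) 0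
  rwa [zero_add, Sum.elim_comp_inl] at h

theorem sympForm_dataPattern (L : Fin n₀ → Pauli) (q : V.Location → Pauli) :
    sympForm (V.dataPattern L) q = sympForm L (atInputs q) := by
  rw [sympForm_apply, sympForm_apply, Fintype.sum_sigma, Fintype.sum_sum_type]
  rw [Finset.sum_eq_zero (s := (Finset.univ : Finset (Fin nₐ))), add_zero]
  · refine Finset.sum_congr rfl fun i _ => ?_
    rw [Finset.sum_eq_single ⟨V.tin (Sum.inl i), Finset.left_mem_Icc.mpr (V.tin_le_tout _)⟩]
    · simp [dataPattern, inputPattern, atInputs]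
    · intro t _ ht
      have : (t : ℕ) ≠ V.tin (Sum.inl i) := fun h => ht (Subtype.ext h)
      simp [dataPattern, inputPattern, this]
    · simp
  · intro j _
    refine Finset.sum_eq_zero fun t _ => ?_
    simp [dataPattern, inputPattern]

theorem pauliWeight_dataPattern (L : Fin n₀ → Pauli) :
    pauliWeight (V.dataPattern L) = pauliWeight L := by
  classical
  symm
  refine Finset.card_bij (fun i _ => (⟨Sum.inl i, V.tin (Sum.inl i),
    Finset.left_mem_Icc.mpr (V.tin_le_tout _)⟩ : V.Location)) (fun i hi => ?_)
    (fun i _ i' _ h => Sum.inl_injective (congrArg Sigma.fst h)) (fun l hl => ?_)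
  · simpa [dataPattern, inputPattern] using hi
  · obtain ⟨w | w, t, ht⟩ := l
    · have h2 : t = V.tin (Sum.inl w) ∧ L w ≠ 0 := by
        simpa [dataPattern, inputPattern] using hl
      obtain ⟨rfl, h2⟩ := h2
      exact ⟨w, by simpa using h2, rfl⟩
    · simp [dataPattern, inputPattern] at hl

/-- The gates of a layer preserve the symplectic product of two histories. -/
theorem sum_present_eq {s q : V.Location → Pauli} (hs : s ∈ V.bareSpace) (hq : q ∈ V.bareSpace)
    (t : ℕ) :
    ∑ w ∈ Finset.univ.filter (fun w => V.tin w ≤ t ∧ t + 1 ≤ V.tout w),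
      ((V.slice s t w).1 * (V.slice q t w).2 + (V.slice s t w).2 * (V.slice q t w).1) =
    ∑ w ∈ Finset.univ.filter (fun w => V.tin w ≤ t ∧ t + 1 ≤ V.tout w),
      ((V.slice s (t + 1) w).1 * (V.slice q (t + 1) w).2 +
        (V.slice s (t + 1) w).2 * (V.slice q (t + 1) w).1) := by
  rw [(V.layer t).sum_eq_sum_parts, (V.layer t).sum_eq_sum_parts]
  refine Finset.sum_congr rfl fun B hB => ?_
  have h := sympForm_eq_of_phaseEq (phaseEq_gate_of_mem_bareSpace hs hB)
    (phaseEq_gate_of_mem_bareSpace hq hB)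
  have hb : ∀ (p : V.Location → Pauli) (j : B), V.slice p t j = p (V.before t hB j) :=
    fun p j => V.slice_apply p _
  have ha : ∀ (p : V.Location → Pauli) (j : B), V.slice p (t + 1) j = p (V.after t hB j) :=
    fun p j => V.slice_apply p _
  simp only [hb, ha]
  exact h.symm

/-- The evenness of the data lines pairs each odd time with the next one: all contributions cancel
except for those of the data inputs. -/
theorem sympForm_slice_add_succ (hEven : V.EvenDataLines) {s q : V.Location → Pauli}
    (hs : s ∈ V.bareSpace) (hq : q ∈ V.bareSpace) {t : ℕ} (ht : Odd t) :
    sympForm (V.slice s t) (V.slice q t) + sympForm (V.slice s (t + 1)) (V.slice q (t + 1)) =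
      sympForm (V.slice (V.dataPattern (atInputs s)) t) (V.slice q t) +
        sympForm (V.slice (V.dataPattern (atInputs s)) (t + 1)) (V.slice q (t + 1)) := by
  have hD : V.slice (V.dataPattern (atInputs s)) t = 0 := by
    funext w
    rw [dataPattern, slice_inputPattern]
    split_ifs with h
    · rcases w with i | j
      · exact absurd (h ▸ (hEven i).1) (Nat.not_even_iff_odd.mpr ht)
      · rfl
    · rfl
  rw [hD, LinearMap.map_zero, LinearMap.zero_apply, zero_add]
  simp only [sympForm_apply]
  rw [← Finset.sum_filter_add_sum_filter_not Finset.univ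
      (fun w => V.tin w ≤ t ∧ t + 1 ≤ V.tout w), V.sum_present_eq hs hq,
    ← Finset.sum_filter_add_sum_filter_not Finset.univ
      (fun w => V.tin w ≤ t ∧ t + 1 ≤ V.tout w) (fun w => (V.slice s (t + 1) w).1 * _ + _),
    ← Finset.sum_filter_add_sum_filter_not Finset.univ
      (fun w => V.tin w ≤ t ∧ t + 1 ≤ V.tout w)
      (fun w => (V.slice (V.dataPattern (atInputs s)) (t + 1) w).1 * _ + _)]
  rw [Finset.sum_eq_zero (s := Finset.univ.filter (fun w => ¬ (V.tin w ≤ t ∧ t + 1 ≤ V.tout w)))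
    (f := fun w => (V.slice s t w).1 * _ + _), add_zero, ← add_assoc, CharTwo.add_self_eq_zero,
    zero_add, Finset.sum_eq_zero
      (s := Finset.univ.filter (fun w => V.tin w ≤ t ∧ t + 1 ≤ V.tout w)), zero_add]
  · refine Finset.sum_congr rfl fun w hw => ?_
    have hw' := (Finset.mem_filter.mp hw).2
    rw [dataPattern, slice_inputPattern]
    by_cases h : t + 1 ∈ Finset.Icc (V.tin w) (V.tout w)
    · have h' := Finset.mem_Icc.mp h
      have htin : t + 1 = V.tin w := by omega
      rw [if_pos htin]
      rcases w with i | j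
      · have h2 : V.slice s (t + 1) (Sum.inl i) = atInputs s i := by
          rw [V.slice_apply s h, atInputs]
          congr 2
          exact Subtype.ext htin
        rw [h2, Sum.elim_inl]
      · have hz : ∀ p ∈ V.bareSpace, (V.slice p (t + 1) (Sum.inr j)).1 = 0 := fun p hp => by
          rw [V.slice_apply p h, ← fst_at_tin_eq_zero hp j]
          congr 3
          exact Subtype.ext htin
        rw [hz s hs, hz q hq]
        simp
    · rw [V.slice_apply_of_notMem q h]
      simp
  · intro w hw
    have hw' := (Finset.mem_filter.mp hw).2
    rw [dataPattern, slice_inputPattern, if_neg (by omega)]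
    simp
  · intro w hw
    have hw' := (Finset.mem_filter.mp hw).2
    by_cases h : t ∈ Finset.Icc (V.tin w) (V.tout w)
    · have h' := Finset.mem_Icc.mp h
      have htout : t = V.tout w := by omega
      rcases w with i | j
      · exact absurd (htout ▸ (hEven i).2) (Nat.not_even_iff_odd.mpr ht)
      · have hz : ∀ p ∈ V.bareSpace, (V.slice p t (Sum.inr j)).1 = 0 := fun p hp => by
          rw [V.slice_apply p h, ← fst_at_tout_eq_zero hp j]
          congr 3
          exact Subtype.ext htout
        rw [hz s hs, hz q hq]
        simp
    · rw [V.slice_apply_of_notMem q h]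
      simp

theorem sympForm_slice_zero {s q : V.Location → Pauli} (hs : s ∈ V.bareSpace)
    (hq : q ∈ V.bareSpace) :
    sympForm (V.slice s 0) (V.slice q 0) =
      sympForm (V.slice (V.dataPattern (atInputs s)) 0) (V.slice q 0) := by
  rw [sympForm_apply, sympForm_apply]
  refine Finset.sum_congr rfl fun w _ => ?_
  rw [dataPattern, slice_inputPattern]
  by_cases h : 0 ∈ Finset.Icc (V.tin w) (V.tout w)
  · have htin : 0 = V.tin w := (Nat.le_zero.mp (Finset.mem_Icc.mp h).1).symm
    rw [if_pos htin]
    rcases w with i | j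
    · have h2 : V.slice s 0 (Sum.inl i) = atInputs s i := by
        rw [V.slice_apply s h, atInputs]
        congr 2
        exact Subtype.ext htin
      rw [h2, Sum.elim_inl]
    · have hz : ∀ p ∈ V.bareSpace, (V.slice p 0 (Sum.inr j)).1 = 0 := fun p hp => by
        rw [V.slice_apply p h, ← fst_at_tin_eq_zero hp j]
        congr 3
        exact Subtype.ext htin
      rw [hz s hs, hz q hq]
      simp
  · rw [V.slice_apply_of_notMem q h]
    simp

/-- An operator that commutes with the gauge group is gauge equivalent to its restriction to the
data inputs. -/
theorem add_dataPattern_mem_gaugeSpace (hEven : V.EvenDataLines) {s : V.Location → Pauli}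
    (hs : s ∈ V.bareSpace) : s + V.dataPattern (atInputs s) ∈ V.gaugeSpace := by
  rw [← orthogonal_bareSpace, mem_orthogonal_sympForm]
  intro q hq
  have key : ∀ k, ∑ t ∈ Finset.range (2 * k + 1), sympForm (V.slice s t) (V.slice q t) =
      ∑ t ∈ Finset.range (2 * k + 1),
        sympForm (V.slice (V.dataPattern (atInputs s)) t) (V.slice q t) := by
    intro k
    induction k with
    | zero => simpa using V.sympForm_slice_zero hs hq
    | succ k ih =>
      rw [show 2 * (k + 1) + 1 = 2 * k + 1 + 1 + 1 by ring, Finset.sum_range_succ,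
        Finset.sum_range_succ, Finset.sum_range_succ _ (2 * k + 1 + 1),
        Finset.sum_range_succ _ (2 * k + 1), ih, add_assoc, add_assoc,
        V.sympForm_slice_add_succ hEven hs hq ⟨k, rfl⟩]
  -- An odd number of slices that covers the whole circuit.
  have hN : V.depth < 2 * V.depth + 1 := by omega
  rw [map_add, LinearMap.add_apply, V.sympForm_eq_sum_slice s q hN,
    V.sympForm_eq_sum_slice _ q hN, key, CharTwo.add_self_eq_zero]

/-! ### The distance of the localized code -/

variable {V} {C : StabilizerCode n₀}

/-- A Pauli error on the data inputs is a gauge operator exactly if it is a stabilizer. -/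
theorem dataPattern_mem_gaugeSpace_iff (hGood : V.IsGoodErrorDetecting C) (L : Fin n₀ → Pauli) :
    V.dataPattern L ∈ V.gaugeSpace ↔ L ∈ pauliSupport C.group := by
  rw [← hGood.phaseEq_op_mul_iff]
  constructor
  · intro h
    have h1 := V.opWithError_add_of_mem_gaugeSpace h 0
    rw [zero_add] at h1
    exact (V.opWithError_dataPattern L).trans h1
  · intro h
    exact mem_gaugeSpace_of_opWithError hGood.op_ne_zero
      ((V.opWithError_dataPattern L).symm.trans h)

/-- The data input of an operator that commutes with the gauge group commutes with the
stabilizers. -/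
theorem atInputs_mem_orthogonal (hGood : V.IsGoodErrorDetecting C) {s : V.Location → Pauli}
    (hs : s ∈ V.bareSpace) : atInputs s ∈ sympForm.orthogonal (pauliSupport C.group) :=
  hGood.mem_orthogonal (phaseEq_op_mul_atInputs hs)

/-- Logical operators of the stabilizer code, placed at the data inputs, commute with
the stabilizers of the localized code. -/
theorem dataPattern_mem_sup (hEven : V.EvenDataLines) (hGood : V.IsGoodErrorDetecting C)
    {L : Fin n₀ → Pauli} (hL : L ∈ sympForm.orthogonal (pauliSupport C.group)) :
    V.dataPattern L ∈ V.gaugeSpace ⊔ V.bareSpace := by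
  rw [bareSpace, ← orthogonal_inf_orthogonal, mem_orthogonal_sympForm]
  rintro q ⟨hq, hq'⟩
  rw [sympForm_dataPattern]
  refine mem_orthogonal_sympForm.mp hL _ ((dataPattern_mem_gaugeSpace_iff hGood _).mp ?_)
  have h := V.gaugeSpace.add_mem hq (V.add_dataPattern_mem_gaugeSpace hEven hq')
  rwa [← add_assoc, pauli_add_self, zero_add] at h

/-- A dressed logical operator is equivalent to a Pauli error on the data inputs that is a
nontrivial logical operator of the stabilizer code. -/
theorem exists_logical (hEven : V.EvenDataLines) (hGood : V.IsGoodErrorDetecting C)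
    {p : V.Location → Pauli} (hp : p ∈ V.gaugeSpace ⊔ V.bareSpace) (hp' : p ∉ V.gaugeSpace) :
    ∃ L, L ∈ sympForm.orthogonal (pauliSupport C.group) ∧ L ∉ pauliSupport C.group ∧
      PhaseEq (V.opWithError p) (V.op * pauliOp L) := by
  obtain ⟨g, hg, s, hs, rfl⟩ := Submodule.mem_sup.mp hp
  have hsD := V.add_dataPattern_mem_gaugeSpace hEven hs
  refine ⟨atInputs s, atInputs_mem_orthogonal hGood hs, fun hL => hp' ?_, ?_⟩
  · have h := V.gaugeSpace.add_mem hsD ((dataPattern_mem_gaugeSpace_iff hGood _).mpr hL)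
    rw [add_assoc, pauli_add_self, add_zero] at h
    exact V.gaugeSpace.add_mem hg h
  · have h1 := V.opWithError_add_of_mem_gaugeSpace (V.gaugeSpace.add_mem hg hsD)
      (V.dataPattern (atInputs s))
    have h2 : V.dataPattern (atInputs s) + (g + (s + V.dataPattern (atInputs s))) = g + s := by
      rw [← add_assoc g, add_comm, add_assoc, pauli_add_self, add_zero]
    rw [h2] at h1
    exact h1.trans (V.opWithError_dataPattern _).symm

/-- By fault tolerance the logical operator can be chosen at most as heavy as the error pattern. -/
theorem exists_logical_le (hEven : V.EvenDataLines) (hGood : V.IsGoodErrorDetecting C)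
    (hFT : V.IsFaultTolerant) {p : V.Location → Pauli}
    (hp : p ∈ V.gaugeSpace ⊔ V.bareSpace) (hp' : p ∉ V.gaugeSpace) :
    ∃ L, L ∈ sympForm.orthogonal (pauliSupport C.group) ∧ L ∉ pauliSupport C.group ∧
      pauliWeight L ≤ pauliWeight p := by
  obtain ⟨L, hL, hL', hpL⟩ := exists_logical hEven hGood hp hp'
  rcases hFT p with h | h | ⟨F, hF, hFp⟩
  · obtain ⟨c, -, hc⟩ := hpL.symm
    rw [h, smul_zero] at hc
    exact absurd hc (op_mul_pauliOp_ne_zero hGood.op_ne_zero L)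
  · exact absurd hpL (h L)
  · have hF' : PhaseEq (V.opWithError p) (V.op * pauliOp F) := hF
    have hLF : L + F ∈ pauliSupport C.group := by
      rw [← hGood.phaseEq_op_mul_iff]
      have h1 : PhaseEq (V.op * pauliOp (L + F)) (V.op * pauliOp L * pauliOp F) := by
        rw [mul_assoc]
        exact (PhaseEq.refl _).mul (phaseEq_pauliOp_add _ _)
      have h2 : PhaseEq (V.op * pauliOp L * pauliOp F) (V.op * (pauliOp F * pauliOp F)) := by
        rw [← mul_assoc]
        exact (hpL.symm.trans hF').mul (PhaseEq.refl _)
      have h3 : PhaseEq (V.op * (pauliOp F * pauliOp F)) (V.op * 1) :=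
        (PhaseEq.refl _).mul ⟨_, zSign_pow_four _, pauliOp_mul_self F⟩
      rw [mul_one] at h3
      exact h1.trans (h2.trans h3)
    have hFL : L + (L + F) = F := by rw [← add_assoc, pauli_add_self, zero_add]
    have hLF' : (L + F) + F = L := by rw [add_assoc, pauli_add_self, add_zero]
    refine ⟨F, ?_, fun h => hL' ?_, hFp⟩
    · rw [← hFL]
      exact Submodule.add_mem _ hL (C.pauliSupport_le_orthogonal hLF)
    · rw [← hLF']
      exact Submodule.add_mem _ hLF h

end CliffordCircuit

open CliffordCircuit

theorem mainTheorem2 (n₀ nₐ : ℕ) (C : StabilizerCode n₀) (V : CliffordCircuit n₀ nₐ)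
    (hEven : V.EvenDataLines) (hGood : V.IsGoodErrorDetecting C) (hFT : V.IsFaultTolerant)
    (d : ℕ∞) (hd : C.distance = d) :
    subsystemDistance V.gaugeGroup = d := by
  rw [← hd, subsystemDistance_eq fun g => V.isPauli_of_mem_gaugeGroup, C.distance_eq]
  apply le_antisymm
  · refine le_iInf₂ fun L hL => ?_
    rw [← V.pauliWeight_dataPattern L]
    exact iInf₂_le (V.dataPattern L) ⟨dataPattern_mem_sup hEven hGood hL.1,
      mt (dataPattern_mem_gaugeSpace_iff hGood L).mp hL.2⟩
  · refine le_iInf₂ fun p hp => ?_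
    obtain ⟨L, hL, hL', hLp⟩ := exists_logical_le hEven hGood hFT hp.1 hp.2
    exact (iInf₂_le L ⟨hL, hL'⟩).trans (Nat.cast_le.mpr hLp)
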